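/- Let $\mathcal C$ be a closed braided monoidal category with unit $I$, braiding $\Phi$, equalizers and coequalizers; $[A,-]$ denotes the right adjoint of $-\otimes A$, $ev:[A,B]\otimes A\to B$ the evaluation and $P^*=[P,I]$. An object $P$ is called finite if the canonical morphism $P\otimes P^*\to[P,P]$ is an isomorphism, and faithfully projective if it is finite and $ev$ induces an isomorphism $P^*\otimes_{[P,P]}P\to I$. An object $T$ is faithfully flat if $T\otimes-$ preserves equalizers and reflects isomorphisms. For an algebra $A$ with multiplication $\nabla$, let $\overline A$ be $A$ with multiplication $\nabla\Phi_{A,A}$; $A$ is an Azumaya algebra if it is faithfully projective and the two morphisms $A\otimes\overline A\to[A,A]$ and $\overline A\otimes A\to[A,A]$, induced respectively by the left action $\nabla(A\otimes\nabla\Phi_{A,A}):A\otimes\overline A\otimes A\to A$ and by the right action $\nabla(\nabla\Phi_{A,A}\otimes A):A\otimes(\overline A\otimes A)\to A$ (preceded by $\Phi_{\overline A\otimes A,A}$), are isomorphisms. Let $H$ be a commutative Hopf algebra in $\mathcal C$ whose underlying object is finite, and suppose that the braiding is $H$-linear, i.e. $\Phi_{M,N}$ is $H$-linear for the codiagonal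 actions for all left $H$-modules $M,N$. Let $T$ be an $H$-Galois object: a right $H$-comodule algebra with coaction $\rho:T\to T\otimes H$, faithfully flat, such that $(\nabla_T\otimes H)(T\otimes\rho):T\otimes T\to T\otimes H$ is an isomorphism. Assume $\Phi_{T,T}=\Phi_{T,T}^{-1}$. Give $H^*$ the unit, multiplication and comultiplication determined by $ev(\eta_{H^*}\otimes H)=\varepsilon_H$, $ev(\nabla_{H^*}\otimes H)=(ev\otimes ev)(H^*\otimes\Phi_{H^*,H}\otimes H)(H^*\otimes H^*\otimes\Delta_H)$ and $(ev\otimes ev)(H^*\otimes\Phi_{H^*,H}\otimes H)(\Delta_{H^*}\otimes H\otimes H)=ev(H^*\otimes\nabla_H)$; let $H^*$ act on $T$ by $(T\otimes ev)(\Phi_{H^*,T}\otimes H)(H^*\otimes\rho)$, and let $\nu$ denote this action. The smash product $T\#H^*$ is the object $T\otimes H^*$ with unit $\eta_T\otimes\eta_{H^*}$ and multiplication $$(\nabla_T\otimes\nabla_{H^*})(T\otimes\nu\otimes H^*\otimes H^*)(T\otimes H^*\otimes\Phi_{H^*,T}\otimes H^*)(T\otimes\Delta_{H^*}\otimes T\otimes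 H^*).$$ Then $T$ is faithfully projective, and $T\#H^*$ is an algebra, and in fact an Azumaya algebra, in $\mathcal C$. -/

import Mathlib

open CategoryTheory MonoidalCategory Limits
open scoped MonObj ComonObj

universe v u

namespace BraidedGalois

noncomputable section

variable {C : Type u} [Category.{v} C] [MonoidalCategory C] [BraidedCategory C]

/-! ### Inner homs and duals -/

section InnerHom

variable [MonoidalClosed C]

/-- The inner hom object `[A, B]`. -/
abbrev innerHom (A B : C) : C := (ihom A).obj B

/-- The evaluation `[A, B] ⊗ A ⟶ B`. Together with `innerHom A B` it represents the functor
`X ↦ Hom(X ⊗ A, B)` (see `lam_ev` and `eq_lam`), so that `[A, -]` is right adjoint to `- ⊗ A`. -/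
def innerEv (A B : C) : innerHom A B ⊗ A ⟶ B :=
  (β_ (innerHom A B) A).hom ≫ (ihom.ev A).app B

/-- The morphism `X ⟶ [A, B]` that corresponds to `f : X ⊗ A ⟶ B`. -/
def lam {X A B : C} (f : X ⊗ A ⟶ B) : X ⟶ innerHom A B :=
  MonoidalClosed.curry ((β_ X A).inv ≫ f)

@[simp]
theorem lam_ev {X A B : C} (f : X ⊗ A ⟶ B) : lam f ▷ A ≫ innerEv A B = f := by
  simp [lam, innerEv, BraidedCategory.braiding_naturality_left_assoc]

theorem eq_lam {X A B : C} (f : X ⊗ A ⟶ B) (g : X ⟶ innerHom A B)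
    (h : g ▷ A ≫ innerEv A B = f) : g = lam f := by
  unfold lam
  rw [MonoidalClosed.eq_curry_iff, MonoidalClosed.uncurry_eq, ← h]
  simp [innerEv, BraidedCategory.braiding_naturality_left_assoc]

/-- The dual `P^* = [P, I]`. -/
abbrev dual (P : C) : C := innerHom P (𝟙_ C)

/-- The evaluation `P^* ⊗ P ⟶ I`. -/
abbrev dualEv (P : C) : dual P ⊗ P ⟶ 𝟙_ C := innerEv P (𝟙_ C)

/-- The canonical morphism `P ⊗ P^* ⟶ [P, P]`. -/
def toEnd (P : C) : P ⊗ dual P ⟶ innerHom P P :=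
  lam ((α_ P (dual P) P).hom ≫ P ◁ dualEv P ≫ (ρ_ P).hom)

/-- `P` is finite if the canonical morphism `P ⊗ P^* ⟶ [P, P]` is an isomorphism. -/
class IsFiniteObj (P : C) : Prop where
  isIso_toEnd : IsIso (toEnd P)

attribute [instance] IsFiniteObj.isIso_toEnd

/-- The dual basis morphism `I ⟶ P ⊗ P^*` of a finite object. -/
def dualBasis (P : C) [IsFiniteObj P] : 𝟙_ C ⟶ P ⊗ dual P :=
  lam (λ_ P).hom ≫ inv (toEnd P)

theorem dualBasis_ev (P : C) [IsFiniteObj P] :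
    dualBasis P ▷ P ≫ (α_ P (dual P) P).hom ≫ P ◁ dualEv P ≫ (ρ_ P).hom = (λ_ P).hom := by
  rw [← lam_ev ((α_ P (dual P) P).hom ≫ P ◁ dualEv P ≫ (ρ_ P).hom), ← comp_whiskerRight_assoc]
  change (dualBasis P ≫ toEnd P) ▷ P ≫ _ = _
  simp [dualBasis]

/-- The right action `P^* ⊗ [P, P] ⟶ P^*` by composition. -/
def dualEndAct (P : C) : dual P ⊗ innerHom P P ⟶ dual P :=
  lam ((α_ (dual P) (innerHom P P) P).hom ≫ dual P ◁ innerEv P P ≫ dualEv P)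

theorem dualEv_balanced (P : C) :
    dualEndAct P ▷ P ≫ dualEv P =
      ((α_ (dual P) (innerHom P P) P).hom ≫ dual P ◁ innerEv P P) ≫ dualEv P := by
  simp [dualEndAct]

/-- The tensor product `P^* ⊗_{[P, P]} P`. -/
abbrev dualTensorEnd [HasCoequalizers C] (P : C) : C :=
  coequalizer (dualEndAct P ▷ P) ((α_ (dual P) (innerHom P P) P).hom ≫ dual P ◁ innerEv P P)

/-- The morphism `P^* ⊗_{[P, P]} P ⟶ I` induced by evaluation. -/
def dualTensorEndEv [HasCoequalizers C] (P : C) : dualTensorEnd P ⟶ 𝟙_ C :=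
  coequalizer.desc (dualEv P) (dualEv_balanced P)

/-- `P` is faithfully projective if it is finite and evaluation induces an isomorphism
`P^* ⊗_{[P, P]} P ≅ I`. -/
structure IsFaithfullyProjective [HasCoequalizers C] (P : C) : Prop where
  finite : IsFiniteObj P
  isIso_ev : IsIso (dualTensorEndEv P)

/-! ### Azumaya algebras

`Ā` is the object `A` with the multiplication `β_{A,A} ≫ μ`. The object `A` is a left
`A ⊗ Ā`-module through `a ⊗ b ⊗ c ↦ a · μ(β(b ⊗ c))` and a right `Ā ⊗ A`-module through
`c ⊗ a ⊗ b ↦ μ(β(c ⊗ a)) · b`. -/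

/-- The canonical morphism `A ⊗ Ā ⟶ [A, A]` that corresponds to the left action of `A ⊗ Ā`. -/
def azumayaLeft (A : C) [MonObj A] : A ⊗ A ⟶ innerHom A A :=
  lam ((α_ A A A).hom ≫ A ◁ ((β_ A A).hom ≫ μ[A]) ≫ μ[A])

/-- The canonical morphism `Ā ⊗ A ⟶ [A, A]` that corresponds to the right action
`A ⊗ (Ā ⊗ A) ⟶ A`; it is the morphism whose composite with `innerEv` is
`(Ā ⊗ A) ⊗ A ⟶ A ⊗ (Ā ⊗ A) ⟶ A`, the braiding followed by this action. -/
def azumayaRight (A : C) [MonObj A] : A ⊗ A ⟶ innerHom A A :=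
  lam ((β_ (A ⊗ A) A).hom ≫ (α_ A A A).inv ≫ ((β_ A A).hom ≫ μ[A]) ▷ A ≫ μ[A])

/-- `A` is an Azumaya algebra if it is faithfully projective and both canonical morphisms
`A ⊗ Ā ⟶ [A, A]` and `Ā ⊗ A ⟶ [A, A]` are isomorphisms. -/
structure IsAzumaya [HasCoequalizers C] (A : C) [MonObj A] : Prop where
  faithfullyProjective : IsFaithfullyProjective A
  isIso_left : IsIso (azumayaLeft A)
  isIso_right : IsIso (azumayaRight A)

/-! ### The dual of a finite Hopf algebra -/

/-- The pairing `(P^* ⊗ P^*) ⊗ (P ⊗ P) ⟶ I`, which evaluates after braiding the second factor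
past the third one. -/
def dualPairing (P : C) : (dual P ⊗ dual P) ⊗ (P ⊗ P) ⟶ 𝟙_ C :=
  tensorμ (dual P) (dual P) P P ≫ (dualEv P ⊗ₘ dualEv P) ≫ (λ_ (𝟙_ C)).hom

/-- The unit of `H^*`, determined by `ev ∘ (η ⊗ H) = ε`. -/
def dualOne (H : C) [ComonObj H] : 𝟙_ C ⟶ dual H :=
  lam ((λ_ H).hom ≫ ε[H])

/-- The multiplication (convolution) of `H^*`, dual to the comultiplication of `H`. -/
def dualMul (H : C) [ComonObj H] : dual H ⊗ dual H ⟶ dual H :=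
  lam ((dual H ⊗ dual H) ◁ Δ[H] ≫ dualPairing H)

/-- The comultiplication of `H^*` for a finite algebra `H`; it is dual to the multiplication of
`H` in the sense of `dualComul_pairing`. -/
def dualComul (H : C) [MonObj H] [IsFiniteObj H] : dual H ⟶ dual H ⊗ dual H :=
  (ρ_ (dual H)).inv ≫ dual H ◁ dualBasis H ≫ (α_ (dual H) H (dual H)).inv ≫
    lam ((α_ (dual H) H H).hom ≫ dual H ◁ μ[H] ≫ dualEv H) ▷ dual H ≫
      (β_ (dual H) (dual H)).hom

theorem braiding_dualPairing (P : C) :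
    (β_ (dual P) (dual P)).hom ▷ (P ⊗ P) ≫ dualPairing P =
      (α_ (dual P) (dual P) (P ⊗ P)).hom ≫ dual P ◁ (α_ (dual P) P P).inv ≫
        dual P ◁ (dualEv P ▷ P) ≫ dual P ◁ (λ_ P).hom ≫ dualEv P := by
  have h : (α_ (dual P) (dual P) P).inv ≫ (β_ (dual P) (dual P)).hom ▷ P ≫
      (α_ (dual P) (dual P) P).hom ≫ dual P ◁ (β_ (dual P) P).hom ≫
        (α_ (dual P) P (dual P)).inv ≫ dualEv P ▷ dual P =
      dual P ◁ dualEv P ≫ (ρ_ (dual P)).hom ≫ (λ_ (dual P)).inv := by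
    rw [← BraidedCategory.braiding_tensor_right_hom_assoc, ← BraidedCategory.braiding_naturality_right,
      braiding_tensorUnit_right]
  calc
    _ = 𝟙 _ ⊗≫ ((α_ (dual P) (dual P) P).inv ≫ (β_ (dual P) (dual P)).hom ▷ P ≫
      (α_ (dual P) (dual P) P).hom ≫ dual P ◁ (β_ (dual P) P).hom ≫
        (α_ (dual P) P (dual P)).inv) ▷ P ⊗≫ (dualEv P ⊗ₘ dualEv P) ⊗≫ 𝟙 _ := by
      simp only [dualPairing, tensorμ]; monoidal
    _ = 𝟙 _ ⊗≫ ((α_ (dual P) (dual P) P).inv ≫ (β_ (dual P) (dual P)).hom ▷ P ≫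
      (α_ (dual P) (dual P) P).hom ≫ dual P ◁ (β_ (dual P) P).hom ≫
        (α_ (dual P) P (dual P)).inv ≫ dualEv P ▷ dual P) ▷ P ⊗≫ dualEv P ⊗≫ 𝟙 _ := by
      rw [MonoidalCategory.tensorHom_def]; monoidal
    _ = _ := by rw [h]; monoidal

/-- `(ev ⊗ ev) ∘ (H^* ⊗ β ⊗ H) ∘ (Δ ⊗ H ⊗ H) = ev ∘ (H^* ⊗ μ)`. -/
theorem dualComul_pairing (H : C) [MonObj H] [IsFiniteObj H] :
    dualComul H ▷ (H ⊗ H) ≫ dualPairing H = dual H ◁ μ[H] ≫ dualEv H := by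
  set f : (dual H ⊗ H) ⊗ H ⟶ 𝟙_ C := (α_ (dual H) H H).hom ≫ dual H ◁ μ[H] ≫ dualEv H with hf
  have hd : dualBasis H ▷ H ≫ (α_ H (dual H) H).hom ≫ H ◁ dualEv H =
      (λ_ H).hom ≫ (ρ_ H).inv := by
    rw [← cancel_mono (ρ_ H).hom]
    simpa using dualBasis_ev H
  calc
    _ = ((ρ_ (dual H)).inv ≫ dual H ◁ dualBasis H ≫ (α_ (dual H) H (dual H)).inv ≫
          lam f ▷ dual H) ▷ (H ⊗ H) ≫
            (β_ (dual H) (dual H)).hom ▷ (H ⊗ H) ≫ dualPairing H := by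
      simp only [dualComul, comp_whiskerRight, Category.assoc, hf]
    _ = 𝟙 _ ⊗≫ dual H ◁ dualBasis H ▷ H ▷ H ⊗≫
          (lam f ▷ (dual H ⊗ H) ≫ dual H ◁ dualEv H) ▷ H ⊗≫ dualEv H := by
      rw [braiding_dualPairing]; monoidal
    _ = 𝟙 _ ⊗≫ dual H ◁ (dualBasis H ▷ H ≫ (α_ H (dual H) H).hom ≫ H ◁ dualEv H) ▷ H ⊗≫
          (lam f ▷ H ≫ dualEv H) := by
      rw [← whisker_exchange]; monoidal
    _ = _ := by
      rw [hd, lam_ev, hf]; monoidal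

end InnerHom

/-! ### Galois objects -/

/-- A right `H`-comodule structure on `T`. -/
class RightComodObj (H : C) [ComonObj H] (T : C) where
  coact : T ⟶ T ⊗ H
  coact_counit : coact ≫ T ◁ ε[H] = (ρ_ T).inv
  coact_comul : coact ≫ T ◁ Δ[H] = coact ≫ coact ▷ H ≫ (α_ T H H).hom

/-- The right coaction `T ⟶ T ⊗ H`. -/
abbrev coact (H : C) [ComonObj H] (T : C) [RightComodObj H T] : T ⟶ T ⊗ H :=
  RightComodObj.coact

/-- The canonical morphism `T ⊗ T ⟶ T ⊗ H`, `x ⊗ y ↦ x y₀ ⊗ y₁`. -/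
def can (H : C) [ComonObj H] (T : C) [MonObj T] [RightComodObj H T] : T ⊗ T ⟶ T ⊗ H :=
  T ◁ coact H T ≫ (α_ T T H).inv ≫ μ[T] ▷ H

/-- `T` is faithfully flat if `T ⊗ -` preserves equalizers and reflects isomorphisms. -/
structure IsFaithfullyFlat (T : C) : Prop where
  preserves : PreservesLimitsOfShape WalkingParallelPair (tensorLeft T)
  reflects : (tensorLeft T).ReflectsIsomorphisms

/-- `T` is an `H`-Galois object: a right `H`-comodule algebra (the coaction is an algebra
morphism into `T ⊗ H`) which is faithfully flat and whose canonical morphism is an isomorphism. -/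
structure IsGaloisObj (H : C) [BimonObj H] (T : C) [MonObj T] [RightComodObj H T] : Prop where
  isMonHom_coact : IsMonHom (coact H T)
  faithfullyFlat : IsFaithfullyFlat T
  isIso_can : IsIso (can H T)

/-- The codiagonal action of `H` on the tensor product of two left `H`-modules. -/
def codiagonalAct (H : C) [BimonObj H] (M N : C) [ModObj H M] [ModObj H N] :
    H ⊗ (M ⊗ N) ⟶ M ⊗ N :=
  Δ[H] ▷ (M ⊗ N) ≫ tensorμ H H M N ≫ (γ[H, M] ⊗ₘ γ[H, N])

/-- The braiding is `H`-linear: for left `H`-modules `M`, `N` the braiding `M ⊗ N ⟶ N ⊗ M` is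
`H`-linear with respect to the codiagonal actions. -/
def IsBraidingLinear (H : C) [BimonObj H] : Prop :=
  ∀ (M N : C) [ModObj H M] [ModObj H N],
    codiagonalAct H M N ≫ (β_ M N).hom = H ◁ (β_ M N).hom ≫ codiagonalAct H N M

/-! ### The smash product `T # H^*` -/

section Smash

variable [MonoidalClosed C]

/-- The left action `H^* ⊗ T ⟶ T` induced by a right `H`-comodule structure. -/
def dualAct (H : C) [ComonObj H] (T : C) [RightComodObj H T] : dual H ⊗ T ⟶ T :=
  dual H ◁ coact H T ≫ (α_ (dual H) T H).inv ≫ (β_ (dual H) T).hom ▷ H ≫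
    (α_ T (dual H) H).hom ≫ T ◁ dualEv H ≫ (ρ_ T).hom

/-- The unit of `T # H^*`. -/
def smashOne (H : C) [ComonObj H] (T : C) [MonObj T] : 𝟙_ C ⟶ T ⊗ dual H :=
  (λ_ (𝟙_ C)).inv ≫ (η[T] ⊗ₘ dualOne H)

/-- The multiplication of `T # H^*`: `(t # a) (t' # a') = t (a₁ · t') # a₂ a'`, where `a₂` is
braided past `t'`. -/
def smashMul (H : C) [BimonObj H] [IsFiniteObj H] (T : C) [MonObj T] [RightComodObj H T] :
    (T ⊗ dual H) ⊗ (T ⊗ dual H) ⟶ T ⊗ dual H :=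
  (α_ T (dual H) (T ⊗ dual H)).hom ≫
    T ◁ (dualComul H ▷ (T ⊗ dual H) ≫ tensorμ (dual H) (dual H) T (dual H) ≫
      (dualAct H T ⊗ₘ dualMul H)) ≫
    (α_ T T (dual H)).inv ≫ μ[T] ▷ dual H

end Smash

end

end BraidedGalois

open BraidedGalois

namespace BraidedGalois

noncomputable section

variable {C : Type u} [Category.{v} C] [MonoidalCategory C] [BraidedCategory C]

/-! ### Inner homs as representing objects -/

section InnerHom

variable [MonoidalClosed C]

/-! Linearity of the braiding, tested on trivial and regular modules, makes `H` cocommutative and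
transparent: `H` braids symmetrically with every object, and then so does `H^*`. Braiding the
coaction therefore gives a left coaction `s ↦ s₁ ⊗ s₀`. Commutativity of `H` makes the antipode an
involution, and this turns the Galois condition into invertibility of `s ⊗ x ↦ s₁ ⊗ s₀ x`
(`isIso_leftCan`).

Since `H` is finite, a morphism `Z ⟶ Y ⊗ T ⊗ H^*` amounts to one `Z ⊗ H ⟶ Y ⊗ T`, which the Galois
map converts into one `Z ⊗ T ⟶ Y ⊗ T`. Hence `Y ⊗ T ⊗ H^* ≅ [T, Y ⊗ T]`
(`isIso_lam_whiskerSmashAct`). For `Y = I` this identifies `T # H^*` with `[T, T]` through its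
action on `T`, so the algebra axioms can be checked on `T`. It also makes `T ⊗ [T, -] ⟶ [T, T ⊗ -]`
invertible at `T` and `T ⊗ T`. By faithful flatness `I` is the equalizer of `T ⇉ T ⊗ T`, so the
comparison is invertible at `I` too, which says that `T` is finite.

A finite object `P` for which `P ⊗ -` reflects isomorphisms is faithfully projective; this covers
`T` and `T ⊗ H^*`. For finite `P` the left Azumaya morphism of `P ⊗ P^* ≅ [P, P]` is invertible
because `P ⊗ P^*` is its own dual (`isIso_lam_endMul`). The right one coincides with it for `T #
H^*`, which braids symmetrically with itself because `T` does and `H^*` is transparent. -/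

theorem comp_lam {X Y A B : C} (g : Y ⟶ X) (f : X ⊗ A ⟶ B) :
    g ≫ lam f = lam (g ▷ A ≫ f) :=
  eq_lam _ _ (by simp)

theorem lam_injective {X A B : C} {f g : X ⊗ A ⟶ B} (h : lam f = lam g) : f = g := by
  rw [← lam_ev f, h, lam_ev]

theorem ihom_map_ev (A : C) {B B' : C} (h : B ⟶ B') :
    (ihom A).map h ▷ A ≫ innerEv A B' = innerEv A B ≫ h := by
  simp [innerEv, BraidedCategory.braiding_naturality_left_assoc]

theorem lam_comp {X A B B' : C} (f : X ⊗ A ⟶ B) (h : B ⟶ B') :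
    lam f ≫ (ihom A).map h = lam (f ≫ h) :=
  eq_lam _ _ (by rw [comp_whiskerRight_assoc, ihom_map_ev, ← Category.assoc, lam_ev])

/-- `lam f` is invertible if `f` represents `Z ↦ (Z ⊗ A ⟶ B)`. -/
theorem isIso_lam_of_represents {X A B : C} (f : X ⊗ A ⟶ B)
    (hex : ∀ {Z : C} (φ : Z ⊗ A ⟶ B), ∃ u : Z ⟶ X, u ▷ A ≫ f = φ)
    (huniq : ∀ {Z : C} (u w : Z ⟶ X), u ▷ A ≫ f = w ▷ A ≫ f → u = w) : IsIso (lam f) := by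
  obtain ⟨u, hu⟩ := hex (innerEv A B)
  have h1 : u ≫ lam f = 𝟙 _ := by
    rw [comp_lam, hu]
    exact (eq_lam _ _ (by simp)).symm
  refine ⟨u, huniq _ _ ?_, h1⟩
  rw [comp_whiskerRight_assoc, hu]
  simp

theorem exists_of_isIso_lam {X A B : C} (f : X ⊗ A ⟶ B) [IsIso (lam f)] {Z : C} (φ : Z ⊗ A ⟶ B) :
    ∃ u : Z ⟶ X, u ▷ A ≫ f = φ :=
  ⟨lam φ ≫ inv (lam f), lam_injective (by simp [← comp_lam])⟩

theorem eq_of_isIso_lam {X A B : C} (f : X ⊗ A ⟶ B) [IsIso (lam f)] {Z : C} {u w : Z ⟶ X}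
    (h : u ▷ A ≫ f = w ▷ A ≫ f) : u = w := by
  rw [← cancel_mono (lam f), comp_lam, comp_lam, h]

/-! ### Finite objects and exact pairings -/

/-- The adjunction `- ⊗ P ⊣ - ⊗ Q` of the exact pairing says that `Z ⊗ Q` represents morphisms out
of `- ⊗ P` into `Z`. -/
theorem isIso_lam_evaluation (Z P Q : C) [ExactPairing P Q] :
    IsIso (lam ((α_ Z Q P).hom ≫ Z ◁ ε_ P Q ≫ (ρ_ Z).hom)) :=
  isIso_lam_of_represents _
    (fun φ => ⟨tensorRightHomEquiv _ _ _ _ φ, (tensorRightHomEquiv _ _ _ _).symm_apply_apply φ⟩)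
    (fun _ _ h => (tensorRightHomEquiv _ P Q _).symm.injective h)

/-- The exact pairing between a finite object and its dual. -/
@[reducible]
def finiteExactPairing (P : C) [IsFiniteObj P] : ExactPairing P (dual P) where
  coevaluation' := dualBasis P
  evaluation' := dualEv P
  evaluation_coevaluation' := by
    rw [← cancel_mono (ρ_ P).hom]
    simpa using dualBasis_ev P
  coevaluation_evaluation' := by
    have h := dualBasis_ev P
    rw [← cancel_mono (λ_ (dual P)).hom]
    -- Morphisms into `P^*` are determined by their pairing with `P`, so the second triangle
    -- identity reduces to the first.
    trans lam ((ρ_ (dual P)).hom ▷ P ≫ dualEv P)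
    · apply eq_lam
      calc
        _ = 𝟙 _ ⊗≫ dual P ◁ dualBasis P ▷ P ⊗≫
            (dualEv P ▷ (dual P ⊗ P) ≫ 𝟙_ C ◁ dualEv P) ⊗≫ 𝟙 _ := by monoidal
        _ = 𝟙 _ ⊗≫ dual P ◁ (dualBasis P ▷ P ≫ (α_ P (dual P) P).hom ≫ P ◁ dualEv P ≫
              (ρ_ P).hom) ⊗≫ dualEv P := by
          rw [← whisker_exchange]; monoidal
        _ = _ := by rw [h]; monoidal
    · symm
      apply eq_lam
      simp

/-- An object with an exact pairing is finite. -/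
theorem isFiniteObj_of_exactPairing (P Q : C) [ExactPairing P Q] : IsFiniteObj P := by
  have h1 := isIso_lam_evaluation P P Q
  have h2 := isIso_lam_evaluation (𝟙_ C) P Q
  constructor
  have h : P ◁ ((λ_ Q).inv ≫ lam ((α_ (𝟙_ C) Q P).hom ≫ 𝟙_ C ◁ ε_ P Q ≫ (ρ_ (𝟙_ C)).hom)) ≫
      toEnd P = lam ((α_ P Q P).hom ≫ P ◁ ε_ P Q ≫ (ρ_ P).hom) := by
    rw [toEnd, comp_lam]
    congr 1
    calc
      _ = (α_ P Q P).hom ≫ P ◁ ((λ_ Q).inv ▷ P ≫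
          (lam ((α_ (𝟙_ C) Q P).hom ≫ 𝟙_ C ◁ ε_ P Q ≫ (ρ_ (𝟙_ C)).hom) ▷ P ≫ dualEv P)) ≫
            (ρ_ P).hom := by monoidal
      _ = _ := by rw [lam_ev]; monoidal
  exact IsIso.of_isIso_fac_left h

theorem IsFiniteObj.tensor (P P' : C) [IsFiniteObj P] [IsFiniteObj P'] : IsFiniteObj (P ⊗ P') :=
  letI := finiteExactPairing P
  letI := finiteExactPairing P'
  isFiniteObj_of_exactPairing (P ⊗ P') (dual P' ⊗ dual P)

/-- The dual of a finite object is finite. -/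
theorem IsFiniteObj.dual (P : C) [IsFiniteObj P] : IsFiniteObj (dual P) :=
  letI := finiteExactPairing P
  letI := BraidedCategory.exactPairing_swap P (BraidedGalois.dual P)
  isFiniteObj_of_exactPairing (BraidedGalois.dual P) P

end InnerHom

section InnerHom

variable [MonoidalClosed C]

/-! ### Faithfully projective objects -/

theorem toEnd_ev (P : C) :
    toEnd P ▷ P ≫ innerEv P P = (α_ P (dual P) P).hom ≫ P ◁ dualEv P ≫ (ρ_ P).hom :=
  lam_ev _

theorem toEnd_dualEndAct (P : C) :
    dual P ◁ toEnd P ≫ dualEndAct P =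
      (α_ (dual P) P (dual P)).inv ≫ dualEv P ▷ dual P ≫ (λ_ (dual P)).hom := by
  have h : dualEndAct P ▷ P ≫ dualEv P = _ := lam_ev _
  trans lam (((α_ (dual P) P (dual P)).inv ≫ dualEv P ▷ dual P ≫ (λ_ (dual P)).hom) ▷ P ≫
    dualEv P)
  · apply eq_lam
    rw [comp_whiskerRight_assoc, h]
    calc
      _ = 𝟙 _ ⊗≫ dual P ◁ (toEnd P ▷ P ≫ innerEv P P) ≫ dualEv P := by monoidal
      _ = 𝟙 _ ⊗≫ ((dual P ⊗ P) ◁ dualEv P ≫ dualEv P ▷ 𝟙_ C) ⊗≫ 𝟙 _ := by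
        rw [toEnd_ev]; monoidal
      _ = _ := by rw [whisker_exchange]; monoidal
  · exact (eq_lam _ _ rfl).symm

/-- It suffices to invert `P ◁ dualTensorEndEv P`. With a dual basis, the inverse is `p ↦ Σ pᵢ ⊗ [pⁱ
⊗ p]`. The nontrivial identity uses the coequalizer relation: `pⁱ ⊗ p f(q) = pⁱ ⊗ (p ⊗ f)·q` is
identified with `pⁱ·(p ⊗ f) ⊗ q = pⁱ(p) f ⊗ q`. -/
theorem isFaithfullyProjective_of_reflects [HasCoequalizers C] (P : C) [IsFiniteObj P]
    (hr : (tensorLeft P).ReflectsIsomorphisms) : IsFaithfullyProjective P := by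
  refine ⟨inferInstance, ?_⟩
  let π : dual P ⊗ P ⟶ dualTensorEnd P := coequalizer.π _ _
  have hπ : π ≫ dualTensorEndEv P = dualEv P := coequalizer.π_desc _ _
  have hcond : dualEndAct P ▷ P ≫ π =
      ((α_ (dual P) (innerHom P P) P).hom ≫ dual P ◁ innerEv P P) ≫ π :=
    coequalizer.condition _ _
  have : Epi (P ◁ π) := inferInstanceAs (Epi ((tensorLeft P).map π))
  let s : P ⟶ P ⊗ dualTensorEnd P :=
    (λ_ P).inv ≫ dualBasis P ▷ P ≫ (α_ P (dual P) P).hom ≫ P ◁ π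
  have h1 : s ≫ P ◁ dualTensorEndEv P = (ρ_ P).inv := by
    simp only [s, Category.assoc, ← whiskerLeft_comp, hπ]
    rw [← cancel_mono (ρ_ P).hom]
    simp [dualBasis_ev]
  have h2 : (P ◁ dualTensorEndEv P ≫ (ρ_ P).hom) ≫ s = 𝟙 _ := by
    rw [← cancel_epi (P ◁ π), ← Category.assoc, ← whiskerLeft_comp_assoc, hπ]
    have hz := @ExactPairing.evaluation_coevaluation _ _ _ P (dual P) (finiteExactPairing P)
    change dualBasis P ▷ P ≫ (α_ P (dual P) P).hom ≫ P ◁ dualEv P = _ at hz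
    calc
      _ = 𝟙 _ ⊗≫ (𝟙_ C ◁ (P ◁ dualEv P ≫ (ρ_ P).hom) ≫ dualBasis P ▷ P) ⊗≫ P ◁ π := by
        simp only [s]; monoidal
      _ = 𝟙 _ ⊗≫ dualBasis P ▷ (P ⊗ dual P ⊗ P) ⊗≫
          P ◁ dual P ◁ ((α_ P (dual P) P).hom ≫ P ◁ dualEv P ≫ (ρ_ P).hom) ≫ P ◁ π := by
        rw [whisker_exchange]; monoidal
      _ = 𝟙 _ ⊗≫ dualBasis P ▷ (P ⊗ dual P ⊗ P) ⊗≫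
          P ◁ (dual P ◁ toEnd P ▷ P ⊗≫
            ((α_ (dual P) (innerHom P P) P).hom ≫ dual P ◁ innerEv P P) ≫ π) := by
        rw [← toEnd_ev]; monoidal
      _ = 𝟙 _ ⊗≫ dualBasis P ▷ (P ⊗ dual P ⊗ P) ⊗≫
          P ◁ ((dual P ◁ toEnd P ≫ dualEndAct P) ▷ P ≫ π) := by
        rw [← hcond]; monoidal
      _ = 𝟙 _ ⊗≫ (dualBasis P ▷ P ≫ (α_ P (dual P) P).hom ≫ P ◁ dualEv P) ▷ (dual P ⊗ P) ⊗≫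
          P ◁ π := by
        rw [toEnd_dualEndAct]; monoidal
      _ = _ := by rw [hz]; monoidal
  have h3 : IsIso (P ◁ dualTensorEndEv P) := by
    refine ⟨(ρ_ P).hom ≫ s, ?_, ?_⟩
    · rw [← Category.assoc, h2]
    · rw [Category.assoc, h1]; simp
  exact @isIso_of_reflects_iso _ _ _ _ _ _ (dualTensorEndEv P) (tensorLeft P) h3 hr

/-! ### Descent along faithfully flat algebras -/

/-- If `T ⊗ -` preserves equalizers and reflects isomorphisms, then the unit of the algebra `T`
is the equalizer of the two morphisms `T ⟶ T ⊗ T` that it induces. -/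
theorem IsFaithfullyFlat.exists_isLimit [HasEqualizers C] {T : C} [MonObj T]
    (hT : IsFaithfullyFlat T) :
    ∃ w : η[T] ≫ (ρ_ T).inv ≫ T ◁ η[T] = η[T] ≫ (λ_ T).inv ≫ η[T] ▷ T,
      Nonempty (IsLimit (Fork.ofι η[T] w)) := by
  have w : η[T] ≫ (ρ_ T).inv ≫ T ◁ η[T] = η[T] ≫ (λ_ T).inv ≫ η[T] ▷ T := by
    rw [rightUnitor_inv_naturality_assoc, leftUnitor_inv_naturality_assoc, ← whisker_exchange,
      unitors_inv_equal]
  refine ⟨w, ?_⟩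
  have := hT.preserves
  have := hT.reflects
  let f := (ρ_ T).inv ≫ T ◁ η[T]
  let g := (λ_ T).inv ≫ η[T] ▷ T
  let l : 𝟙_ C ⟶ equalizer f g := equalizer.lift η[T] w
  -- After tensoring with `T` the fork is split by multiplication. As `T ⊗ -` preserves the actual
  -- equalizer, the comparison `l` becomes invertible after tensoring.
  let S : IsSplitEqualizer (T ◁ f) (T ◁ g) (T ◁ η[T]) := by
    refine IsSplitEqualizer.mk (μ[T] ≫ (ρ_ T).inv) ((α_ T T T).inv ≫ μ[T] ▷ T) ?_ ?_ ?_ ?_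
    · rw [← whiskerLeft_comp, ← whiskerLeft_comp]
      exact congrArg _ w
    · rw [← Category.assoc, MonObj.mul_one, Iso.hom_inv_id]
    · calc
        _ = (ρ_ T).inv ▷ T ≫ (T ◁ η[T] ≫ μ[T]) ▷ T := by
          simp only [g]; monoidal
        _ = _ := by rw [MonObj.mul_one]; monoidal
    · calc
        _ = (ρ_ (T ⊗ T)).inv ≫ (T ⊗ T) ◁ η[T] ≫ μ[T] ▷ T := by
          simp only [f]; monoidal
        _ = _ := by rw [whisker_exchange]; monoidal
  have hl : IsIso (T ◁ l) := by
    let i := isLimitForkMapOfIsLimit (tensorLeft T) _ (equalizerIsEqualizer f g)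
    have e := IsLimit.conePointUniqueUpToIso_hom_comp S.isEqualizer i WalkingParallelPair.zero
    have : T ◁ l = (IsLimit.conePointUniqueUpToIso S.isEqualizer i).hom := by
      apply Fork.IsLimit.hom_ext i
      refine Eq.trans ?_ e.symm
      change T ◁ l ≫ T ◁ equalizer.ι f g = T ◁ η[T]
      rw [← whiskerLeft_comp, equalizer.lift_ι]
    rw [this]
    exact Iso.isIso_hom _
  have : IsIso l := @isIso_of_reflects_iso _ _ _ _ _ _ l (tensorLeft T) hl _
  exact ⟨IsLimit.ofIsoLimit (equalizerIsEqualizer f g)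
    (Fork.ext (asIso l).symm (by
      rw [Iso.symm_hom, Iso.inv_comp_eq]
      exact (equalizer.lift_ι _ _).symm))⟩

/-- The canonical morphism `T ⊗ [P, X] ⟶ [P, T ⊗ X]`. -/
def tensorInnerHom (T P X : C) : T ⊗ innerHom P X ⟶ innerHom P (T ⊗ X) :=
  lam ((α_ T (innerHom P X) P).hom ≫ T ◁ innerEv P X)

theorem tensorInnerHom_naturality (T P : C) {X Y : C} (f : X ⟶ Y) :
    T ◁ (ihom P).map f ≫ tensorInnerHom T P Y = tensorInnerHom T P X ≫ (ihom P).map (T ◁ f) := by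
  rw [tensorInnerHom, tensorInnerHom, comp_lam, lam_comp]
  congr 1
  rw [Category.assoc, ← whiskerLeft_comp, ← ihom_map_ev]
  simp

theorem isIso_tensorInnerHom_of_iso (T P : C) {X Y : C} (e : X ≅ Y)
    (h : IsIso (tensorInnerHom T P X)) : IsIso (tensorInnerHom T P Y) := by
  have := tensorInnerHom_naturality T P e.hom
  exact IsIso.of_isIso_fac_left this

/-- For `P = T` the right-hand side is `toEnd T`, so finiteness of `T` becomes invertibility of the
comparison at the unit object. -/
theorem tensorInnerHom_unit (T P : C) :
    tensorInnerHom T P (𝟙_ C) ≫ (ihom P).map (ρ_ T).hom =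
      lam ((α_ T (dual P) P).hom ≫ T ◁ dualEv P ≫ (ρ_ T).hom) := by
  rw [tensorInnerHom, lam_comp, Category.assoc]

/-- If `T` is a faithfully flat algebra and `T ⊗ [P, -] ⟶ [P, T ⊗ -]` is invertible at
`T` and `T ⊗ T`, then it is invertible at the unit object. -/
theorem IsFaithfullyFlat.isIso_tensorInnerHom_unit [HasEqualizers C] {T : C} [MonObj T]
    (hT : IsFaithfullyFlat T) (P : C) (h₁ : IsIso (tensorInnerHom T P T))
    (h₂ : IsIso (tensorInnerHom T P (T ⊗ T))) : IsIso (tensorInnerHom T P (𝟙_ C)) := by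
  obtain ⟨w, ⟨hl⟩⟩ := hT.exists_isLimit
  have := hT.preserves
  let i₁ := isLimitForkMapOfIsLimit (ihom P ⋙ tensorLeft T) _ hl
  let i₂ := isLimitForkMapOfIsLimit (tensorLeft T ⋙ ihom P) _ hl
  let c : parallelPair ((ihom P ⋙ tensorLeft T).map ((ρ_ T).inv ≫ T ◁ η[T]))
      ((ihom P ⋙ tensorLeft T).map ((λ_ T).inv ≫ η[T] ▷ T)) ≅
    parallelPair ((tensorLeft T ⋙ ihom P).map ((ρ_ T).inv ≫ T ◁ η[T]))
      ((tensorLeft T ⋙ ihom P).map ((λ_ T).inv ≫ η[T] ▷ T)) :=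
    parallelPair.ext (asIso (tensorInnerHom T P T)) (asIso (tensorInnerHom T P (T ⊗ T)))
      (tensorInnerHom_naturality T P _) (tensorInnerHom_naturality T P _)
  have e : tensorInnerHom T P (𝟙_ C) = (IsLimit.conePointsIsoOfNatIso i₁ i₂ c).hom := by
    apply Fork.IsLimit.hom_ext i₂
    refine Eq.trans ?_
      (IsLimit.conePointsIsoOfNatIso_hom_comp i₁ i₂ c WalkingParallelPair.zero).symm
    exact (tensorInnerHom_naturality T P η[T]).symm
  rw [e]
  infer_instance

end InnerHom

/-! ### Objects that braid symmetrically -/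

/-- The double braiding of `X` and `Y` is the identity. -/
def SymmetricPair (X Y : C) : Prop := (β_ X Y).hom ≫ (β_ Y X).hom = 𝟙 _

theorem SymmetricPair.symm {X Y : C} (h : SymmetricPair X Y) : SymmetricPair Y X := by
  have : (β_ Y X).hom = (β_ X Y).inv := by
    rw [← cancel_epi (β_ X Y).hom, Iso.hom_inv_id]
    exact h
  rw [SymmetricPair, this, Iso.inv_hom_id]

theorem SymmetricPair.hom_eq {X Y : C} (h : SymmetricPair X Y) :
    (β_ Y X).hom = (β_ X Y).inv := by
  rw [← cancel_epi (β_ X Y).hom, Iso.hom_inv_id]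
  exact h

theorem SymmetricPair.of_hom_eq {X Y : C} (h : (β_ Y X).hom = (β_ X Y).inv) :
    SymmetricPair X Y := by
  rw [SymmetricPair, h, Iso.hom_inv_id]

theorem SymmetricPair.tensor_right {X Y Z : C} (hY : SymmetricPair X Y)
    (hZ : SymmetricPair X Z) : SymmetricPair X (Y ⊗ Z) := by
  apply SymmetricPair.of_hom_eq
  rw [BraidedCategory.braiding_tensor_left_hom, BraidedCategory.braiding_tensor_right_inv,
    hY.hom_eq, hZ.hom_eq]

/-- Every object braids symmetrically with `X`. -/
def IsTransparent (X : C) : Prop := ∀ Y : C, SymmetricPair X Y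

/-- Braiding an object past one factor of a contracted pair amounts to braiding it back past the
other one. -/
theorem braid_contract {A B : C} (e : A ⊗ B ⟶ 𝟙_ C) (X : C) :
    (β_ A X).hom ▷ B ≫ (α_ X A B).hom ≫ X ◁ e ≫ (ρ_ X).hom =
      (α_ A X B).hom ≫ A ◁ (β_ B X).inv ≫ (α_ A B X).inv ≫ e ▷ X ≫ (λ_ X).hom := by
  have h := BraidedCategory.braiding_naturality_left e X
  rw [BraidedCategory.braiding_tensor_left_hom, braiding_tensorUnit_left] at h
  rw [← Category.comp_id (λ_ X).hom, ← Iso.inv_hom_id (ρ_ X), ← Category.assoc (λ_ X).hom,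
    ← Category.assoc (e ▷ X), h]
  simp

theorem braid_inv_contract {A B : C} (e : A ⊗ B ⟶ 𝟙_ C) (X : C) :
    (β_ X A).inv ▷ B ≫ (α_ X A B).hom ≫ X ◁ e ≫ (ρ_ X).hom =
      (α_ A X B).hom ≫ A ◁ (β_ X B).hom ≫ (α_ A B X).inv ≫ e ▷ X ≫ (λ_ X).hom := by
  have h := BraidedCategory.braiding_naturality_right X e
  rw [BraidedCategory.braiding_tensor_right_hom, braiding_tensorUnit_right] at h
  rw [← cancel_mono (λ_ X).inv]
  simp only [Category.assoc] at h ⊢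
  rw [h]
  simp

/-- The trivial action of a bialgebra. -/
@[reducible]
def trivialModObj (H : C) [BimonObj H] (X : C) : ModObj H X where
  smul := ε[H] ▷ X ≫ (λ_ X).hom
  one_smul := by
    change η[H] ▷ X ≫ ε[H] ▷ X ≫ (λ_ X).hom = (λ_ X).hom
    rw [← comp_whiskerRight_assoc, BimonObj.one_counit]
    simp
  mul_smul := by
    change μ[H] ▷ X ≫ ε[H] ▷ X ≫ (λ_ X).hom =
      (α_ H H X).hom ≫ H ◁ (ε[H] ▷ X ≫ (λ_ X).hom) ≫ ε[H] ▷ X ≫ (λ_ X).hom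
    rw [← comp_whiskerRight_assoc, BimonObj.mul_counit, Comon.tensorObj_counit,
      MonoidalCategory.tensorHom_def']
    monoidal

/-- Take `X` trivial and `H` regular, and let `g` act on `x ⊗ 1`. Acting first braids `g` past `x`,
and the braiding then brings it back; braiding first and then acting gives `g ⊗ x`. So the double
braiding is the identity. -/
theorem IsBraidingLinear.isTransparent {H : C} [BimonObj H] (h : IsBraidingLinear H) :
    IsTransparent H := by
  intro X
  let _ : ModObj H X := trivialModObj H X
  let _ : ModObj H H := ModObj.regular H
  have h' : (Δ[H] ▷ (X ⊗ H) ≫ tensorμ H H X H ≫ ((ε[H] ▷ X ≫ (λ_ X).hom) ⊗ₘ μ[H])) ≫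
      (β_ X H).hom = H ◁ (β_ X H).hom ≫
      (Δ[H] ▷ (H ⊗ X) ≫ tensorμ H H H X ≫ (μ[H] ⊗ₘ (ε[H] ▷ X ≫ (λ_ X).hom))) := h X H
  have hL : Δ[H] ▷ (X ⊗ H) ≫ tensorμ H H X H ≫ ((ε[H] ▷ X ≫ (λ_ X).hom) ⊗ₘ μ[H]) =
      (α_ H X H).inv ≫ (β_ H X).hom ▷ H ≫ (α_ X H H).hom ≫ X ◁ μ[H] := by
    calc
      _ = 𝟙 _ ⊗≫ Δ[H] ▷ (X ⊗ H) ⊗≫ (H ◁ (β_ H X).hom ≫ ε[H] ▷ (X ⊗ H)) ▷ H ⊗≫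
          X ◁ μ[H] := by
        simp only [tensorμ, MonoidalCategory.tensorHom_def]; monoidal
      _ = 𝟙 _ ⊗≫ (Δ[H] ≫ ε[H] ▷ H) ▷ (X ⊗ H) ⊗≫ (β_ H X).hom ▷ H ⊗≫ X ◁ μ[H] := by
        rw [whisker_exchange]; monoidal
      _ = _ := by rw [ComonObj.counit_comul]; monoidal
  have hR : Δ[H] ▷ (H ⊗ X) ≫ tensorμ H H H X ≫ (μ[H] ⊗ₘ (ε[H] ▷ X ≫ (λ_ X).hom)) =
      (α_ H H X).inv ≫ μ[H] ▷ X := by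
    calc
      _ = 𝟙 _ ⊗≫ Δ[H] ▷ (H ⊗ X) ⊗≫ H ◁ ((β_ H H).hom ≫ H ◁ ε[H]) ▷ X ⊗≫ μ[H] ▷ X := by
        simp only [tensorμ, MonoidalCategory.tensorHom_def']; monoidal
      _ = 𝟙 _ ⊗≫ (Δ[H] ≫ H ◁ ε[H]) ▷ (H ⊗ X) ⊗≫ H ◁ (β_ (𝟙_ C) H).hom ▷ X ⊗≫ μ[H] ▷ X := by
        rw [← BraidedCategory.braiding_naturality_left]; monoidal
      _ = _ := by rw [ComonObj.comul_counit, braiding_tensorUnit_left]; monoidal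
  rw [hL, hR] at h'
  have h2 : H ◁ ((ρ_ X).inv ≫ X ◁ η[H]) ≫ ((α_ H X H).inv ≫ (β_ H X).hom ▷ H ≫
        (α_ X H H).hom ≫ X ◁ μ[H]) ≫ (β_ X H).hom =
      H ◁ ((ρ_ X).inv ≫ X ◁ η[H]) ≫ H ◁ (β_ X H).hom ≫ (α_ H H X).inv ≫ μ[H] ▷ X := by
    rw [h']
  have eL : H ◁ ((ρ_ X).inv ≫ X ◁ η[H]) ≫ ((α_ H X H).inv ≫ (β_ H X).hom ▷ H ≫
        (α_ X H H).hom ≫ X ◁ μ[H]) ≫ (β_ X H).hom = (β_ H X).hom ≫ (β_ X H).hom := by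
    calc
      _ = 𝟙 _ ⊗≫ ((H ⊗ X) ◁ η[H] ≫ (β_ H X).hom ▷ H) ⊗≫ X ◁ μ[H] ≫ (β_ X H).hom := by monoidal
      _ = 𝟙 _ ⊗≫ (β_ H X).hom ⊗≫ X ◁ (H ◁ η[H] ≫ μ[H]) ≫ (β_ X H).hom := by
        rw [whisker_exchange]; monoidal
      _ = _ := by rw [MonObj.mul_one]; monoidal
  have eR : H ◁ ((ρ_ X).inv ≫ X ◁ η[H]) ≫ H ◁ (β_ X H).hom ≫ (α_ H H X).inv ≫ μ[H] ▷ X = 𝟙 _ := by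
    calc
      _ = 𝟙 _ ⊗≫ H ◁ (X ◁ η[H] ≫ (β_ X H).hom) ⊗≫ μ[H] ▷ X := by monoidal
      _ = 𝟙 _ ⊗≫ H ◁ (β_ X (𝟙_ C)).hom ⊗≫ (H ◁ η[H] ≫ μ[H]) ▷ X := by
        rw [BraidedCategory.braiding_naturality_right]; monoidal
      _ = _ := by rw [MonObj.mul_one, braiding_tensorUnit_right]; monoidal
  rw [eL, eR] at h2
  exact h2

/-- In `H ⊗ H` with regular factors, `g` sends `1 ⊗ 1` to `Δ(g)`, while `1 ⊗ 1` is fixed by the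
braiding. -/
theorem IsBraidingLinear.comul_braiding {H : C} [BimonObj H] (h : IsBraidingLinear H) :
    Δ[H] ≫ (β_ H H).hom = Δ[H] := by
  let _ : ModObj H H := ModObj.regular H
  have h' : (Δ[H] ▷ (H ⊗ H) ≫ tensorμ H H H H ≫ (μ[H] ⊗ₘ μ[H])) ≫
      (β_ H H).hom = H ◁ (β_ H H).hom ≫
      (Δ[H] ▷ (H ⊗ H) ≫ tensorμ H H H H ≫ (μ[H] ⊗ₘ μ[H])) := h H H
  have key : (ρ_ H).inv ≫ H ◁ ((λ_ (𝟙_ C)).inv ≫ (η[H] ⊗ₘ η[H])) ≫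
      (Δ[H] ▷ (H ⊗ H) ≫ tensorμ H H H H ≫ (μ[H] ⊗ₘ μ[H])) = Δ[H] := by
    have e : (H ⊗ H) ◁ (η[H] ⊗ₘ η[H]) ≫ tensorμ H H H H ≫ (μ[H] ⊗ₘ μ[H]) =
        tensorμ H H (𝟙_ C) (𝟙_ C) ≫ ((ρ_ H).hom ⊗ₘ (ρ_ H).hom) := by
      rw [← Category.assoc, tensorμ_natural_right, Category.assoc, tensorHom_comp_tensorHom,
        MonObj.mul_one]
    calc
      _ = (ρ_ H).inv ≫ H ◁ (λ_ (𝟙_ C)).inv ≫ (H ◁ (η[H] ⊗ₘ η[H]) ≫ Δ[H] ▷ (H ⊗ H)) ≫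
        tensorμ H H H H ≫ (μ[H] ⊗ₘ μ[H]) := by simp
      _ = (ρ_ H).inv ≫ H ◁ (λ_ (𝟙_ C)).inv ≫ Δ[H] ▷ (𝟙_ C ⊗ 𝟙_ C) ≫
        (H ⊗ H) ◁ (η[H] ⊗ₘ η[H]) ≫ tensorμ H H H H ≫ (μ[H] ⊗ₘ μ[H]) := by
        rw [whisker_exchange]; simp only [Category.assoc]
      _ = _ := by
        rw [e]
        simp only [tensorμ, braiding_tensorUnit_right]
        monoidal
  have h2 := congrArg (fun f => (ρ_ H).inv ≫ H ◁ ((λ_ (𝟙_ C)).inv ≫ (η[H] ⊗ₘ η[H])) ≫ f) h'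
  have e2 : (η[H] ⊗ₘ η[H]) ≫ (β_ H H).hom = η[H] ⊗ₘ η[H] := by
    rw [BraidedCategory.braiding_naturality, braiding_tensorUnit_right, ← unitors_equal]
    simp
  rw [← whiskerLeft_comp_assoc, Category.assoc (λ_ (𝟙_ C)).inv, e2, key] at h2
  rw [← key]
  refine Eq.trans ?_ (h2.trans key.symm)
  simp only [Category.assoc]

section InnerHom

variable [MonoidalClosed C]

/-- The dual of a transparent finite object is transparent. -/
theorem IsTransparent.dual {H : C} [IsFiniteObj H] (h : IsTransparent H) :
    IsTransparent (dual H) := by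
  intro X
  let _ := finiteExactPairing H
  apply SymmetricPair.symm
  apply SymmetricPair.of_hom_eq
  apply (tensorRightHomEquiv _ H (BraidedGalois.dual H) _).symm.injective
  change (β_ (BraidedGalois.dual H) X).hom ▷ H ≫ (α_ _ _ _).hom ≫ X ◁ dualEv H ≫ (ρ_ X).hom =
    (β_ X (BraidedGalois.dual H)).inv ▷ H ≫ (α_ _ _ _).hom ≫ X ◁ dualEv H ≫ (ρ_ X).hom
  rw [braid_contract, braid_inv_contract, (h X).hom_eq]

end InnerHom

/-! ### The left coaction obtained from a right coaction by braiding -/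

/-- The left coaction `T ⟶ H ⊗ T` obtained by braiding a right coaction. -/
def leftCoact (H : C) [ComonObj H] (T : C) [RightComodObj H T] : T ⟶ H ⊗ T :=
  coact H T ≫ (β_ T H).hom

theorem leftCoact_counit (H : C) [ComonObj H] (T : C) [RightComodObj H T] :
    leftCoact H T ≫ ε[H] ▷ T = (λ_ T).inv := by
  rw [leftCoact, Category.assoc, ← BraidedCategory.braiding_naturality_right,
    ← Category.assoc, RightComodObj.coact_counit, braiding_tensorUnit_right]
  simp

/-- Braiding past `T` interchanges the two copies of `H` produced by the coaction; cocommutativity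
undoes the interchange. -/
theorem leftCoact_comul {H : C} [ComonObj H] (hc : Δ[H] ≫ (β_ H H).hom = Δ[H]) (T : C)
    [RightComodObj H T] :
    leftCoact H T ≫ Δ[H] ▷ T = leftCoact H T ≫ H ◁ leftCoact H T ≫ (α_ H H T).inv := by
  have h := RightComodObj.coact_comul (H := H) (T := T)
  calc
    _ = coact H T ≫ T ◁ Δ[H] ≫ T ◁ (β_ H H).hom ≫ (β_ T (H ⊗ H)).hom := by
      rw [← whiskerLeft_comp_assoc, hc, leftCoact, Category.assoc,
        BraidedCategory.braiding_naturality_right]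
    _ = coact H T ≫ coact H T ▷ H ≫ 𝟙 _ ⊗≫ (T ◁ (β_ H H).hom ⊗≫ (β_ T H).hom ▷ H ⊗≫
          H ◁ (β_ T H).hom) ⊗≫ 𝟙 _ := by
      rw [← Category.assoc, h, BraidedCategory.braiding_tensor_right_hom]; monoidal
    _ = coact H T ≫ coact H T ▷ H ≫ (β_ T H).hom ▷ H ⊗≫ H ◁ (β_ T H).hom ⊗≫
          (β_ H H).hom ▷ T := by
      rw [← BraidedCategory.yang_baxter']
    _ = coact H T ≫ leftCoact H T ▷ H ≫ (β_ (H ⊗ T) H).hom ≫ (α_ H H T).inv := by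
      rw [leftCoact, BraidedCategory.braiding_tensor_left_hom]; monoidal
    _ = _ := by
      rw [BraidedCategory.braiding_naturality_left_assoc]
      simp only [leftCoact, Category.assoc]

theorem tensorμ_braiding {H T : C} (h : SymmetricPair H T) :
    tensorμ T H T H ≫ (β_ (T ⊗ T) (H ⊗ H)).hom =
      ((β_ T H).hom ⊗ₘ (β_ T H).hom) ≫ tensorμ H T H T := by
  have h : (β_ H T).hom ≫ (β_ T H).hom = 𝟙 _ := h
  calc
    _ = 𝟙 _ ⊗≫ T ◁ ((β_ H T).hom ≫ (β_ T H).hom) ▷ H ⊗≫ (β_ T H).hom ▷ (T ⊗ H) ⊗≫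
          (H ⊗ T) ◁ (β_ T H).hom ⊗≫ H ◁ (β_ T H).hom ▷ T ⊗≫ 𝟙 _ := by
      simp only [tensorμ, BraidedCategory.braiding_tensor_left_hom,
        BraidedCategory.braiding_tensor_right_hom]
      monoidal
    _ = _ := by
      rw [h, MonoidalCategory.tensorHom_def, tensorμ]; monoidal

theorem mul_leftCoact {H : C} [BimonObj H] {T : C} [MonObj T] [RightComodObj H T]
    (h : SymmetricPair H T) (hT : IsMonHom (coact H T)) :
    μ[T] ≫ leftCoact H T =
      (leftCoact H T ⊗ₘ leftCoact H T) ≫ tensorμ H T H T ≫ (μ[H] ⊗ₘ μ[T]) := by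
  have h1 : μ[T] ≫ coact H T = (coact H T ⊗ₘ coact H T) ≫ tensorμ T H T H ≫ (μ[T] ⊗ₘ μ[H]) :=
    IsMonHom.mul_hom _
  rw [leftCoact, ← Category.assoc, h1]
  simp only [Category.assoc]
  rw [BraidedCategory.braiding_naturality, ← Category.assoc (tensorμ T H T H),
    tensorμ_braiding h, ← tensorHom_comp_tensorHom]
  simp only [Category.assoc]

section InnerHom

variable [MonoidalClosed C]

/-! ### The action of the dual -/

/-- In this form no braiding remains outside the left coaction: `braid_contract` moves the braiding
from `H^*` to `H`, and symmetry identifies the resulting inverse braiding with the one in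
`leftCoact`. -/
theorem dualAct_eq {H : C} [ComonObj H] {T : C} [RightComodObj H T] (h : SymmetricPair H T) :
    dualAct H T =
      dual H ◁ leftCoact H T ≫ (α_ (dual H) H T).inv ≫ dualEv H ▷ T ≫ (λ_ T).hom := by
  rw [dualAct, braid_contract, leftCoact, h.hom_eq]
  simp

theorem dualOne_dualAct {H : C} [ComonObj H] {T : C} [RightComodObj H T]
    (h : SymmetricPair H T) : dualOne H ▷ T ≫ dualAct H T = (λ_ T).hom := by
  have h1 : dualOne H ▷ H ≫ dualEv H = (λ_ H).hom ≫ ε[H] := lam_ev _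
  rw [dualAct_eq h]
  calc
    _ = (dualOne H ▷ T ≫ dual H ◁ leftCoact H T) ≫ (α_ (dual H) H T).inv ≫ dualEv H ▷ T ≫
        (λ_ T).hom := by simp
    _ = 𝟙_ C ◁ leftCoact H T ⊗≫ (dualOne H ▷ H ≫ dualEv H) ▷ T ⊗≫ 𝟙 _ := by
      rw [← whisker_exchange]; monoidal
    _ = 𝟙 _ ⊗≫ (leftCoact H T ≫ ε[H] ▷ T) ⊗≫ 𝟙 _ := by rw [h1]; monoidal
    _ = _ := by rw [leftCoact_counit]; monoidal

/-- This turns the pairing into nested evaluations preceded by an inverse braiding of `P ⊗ P`, which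
a cocommutative comultiplication absorbs. -/
theorem dualPairing_eq (P : C) :
    dualPairing P = (dual P ⊗ dual P) ◁ (β_ P P).inv ≫ (α_ (dual P) (dual P) (P ⊗ P)).hom ≫
      dual P ◁ ((α_ (dual P) P P).inv ≫ dualEv P ▷ P ≫ (λ_ P).hom) ≫ dualEv P := by
  calc
    _ = 𝟙 _ ⊗≫ dual P ◁ ((β_ (dual P) P).hom ▷ P ≫ (α_ P (dual P) P).hom ≫
          P ◁ dualEv P ≫ (ρ_ P).hom) ≫ dualEv P := by
      simp only [dualPairing, tensorμ, MonoidalCategory.tensorHom_def']; monoidal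
    _ = _ := by rw [braid_contract]; monoidal

theorem dualMul_dualAct {H : C} [ComonObj H] (hc : Δ[H] ≫ (β_ H H).hom = Δ[H]) {T : C}
    [RightComodObj H T] (h : SymmetricPair H T) :
    dualMul H ▷ T ≫ dualAct H T =
      (α_ (dual H) (dual H) T).hom ≫ dual H ◁ dualAct H T ≫ dualAct H T := by
  have h1 : dualMul H ▷ H ≫ dualEv H = (dual H ⊗ dual H) ◁ Δ[H] ≫ dualPairing H := lam_ev _
  have hc' : Δ[H] ≫ (β_ H H).inv = Δ[H] := by rw [Iso.comp_inv_eq, hc]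
  rw [dualPairing_eq, ← whiskerLeft_comp_assoc, hc'] at h1
  rw [dualAct_eq h]
  calc
    _ = (dualMul H ▷ T ≫ dual H ◁ leftCoact H T) ≫ (α_ (dual H) H T).inv ≫ dualEv H ▷ T ≫
        (λ_ T).hom := by simp
    _ = (dual H ⊗ dual H) ◁ leftCoact H T ⊗≫ (dualMul H ▷ H ≫ dualEv H) ▷ T ⊗≫ 𝟙 _ := by
      rw [← whisker_exchange]; monoidal
    _ = 𝟙 _ ⊗≫ dual H ◁ dual H ◁ (leftCoact H T ≫ Δ[H] ▷ T) ⊗≫ dual H ◁ dualEv H ▷ (H ⊗ T) ⊗≫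
        dualEv H ▷ T ⊗≫ 𝟙 _ := by rw [h1]; monoidal
    _ = 𝟙 _ ⊗≫ dual H ◁ dual H ◁ leftCoact H T ⊗≫
        dual H ◁ ((dual H ⊗ H) ◁ leftCoact H T ≫ dualEv H ▷ (H ⊗ T)) ⊗≫
        dualEv H ▷ T ⊗≫ 𝟙 _ := by rw [leftCoact_comul hc]; monoidal
    _ = _ := by rw [whisker_exchange]; monoidal

/-- The interchanges `H T H T ⟶ H H T T` and back cancel because `H` and `T` braid symmetrically;
the rest is coherence of `tensorμ`. -/
theorem tensorμ_contract {A B H T : C} (h : SymmetricPair H T) (e : A ⊗ H ⟶ 𝟙_ C)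
    (e' : B ⊗ H ⟶ 𝟙_ C) :
    tensorμ A B (H ⊗ T) (H ⊗ T) ≫
        (((α_ A H T).inv ≫ e ▷ T ≫ (λ_ T).hom) ⊗ₘ ((α_ B H T).inv ≫ e' ▷ T ≫ (λ_ T).hom)) =
      (A ⊗ B) ◁ tensorμ H T H T ≫ (α_ (A ⊗ B) (H ⊗ H) (T ⊗ T)).inv ≫
        (tensorμ A B H H ≫ (e ⊗ₘ e') ≫ (λ_ (𝟙_ C)).hom) ▷ (T ⊗ T) ≫ (λ_ (T ⊗ T)).hom := by
  have hs : (β_ T H).hom ≫ (β_ H T).hom = 𝟙 _ := h.symm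
  have h1 : tensorμ H T H T ≫ tensorμ H H T T = 𝟙 _ := by
    calc
      _ = 𝟙 _ ⊗≫ H ◁ ((β_ T H).hom ≫ (β_ H T).hom) ▷ T ⊗≫ 𝟙 _ := by
        simp only [tensorμ]; monoidal
      _ = _ := by rw [hs]; monoidal
  have h3 : tensorμ (𝟙_ C) (𝟙_ C) T T ≫ ((λ_ T).hom ⊗ₘ (λ_ T).hom) =
      (λ_ (𝟙_ C)).hom ▷ (T ⊗ T) ≫ (λ_ (T ⊗ T)).hom := by
    rw [tensor_left_unitality, ← comp_whiskerRight_assoc, Iso.hom_inv_id]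
    simp
  have h2 := tensor_associativity A B H H T T
  rw [← cancel_mono (tensorHom (α_ A H T).inv (α_ B H T).inv)] at h2
  simp only [Category.assoc, tensorHom_comp_tensorHom, Iso.hom_inv_id] at h2
  calc
    _ = (A ⊗ B) ◁ (tensorμ H T H T ≫ tensorμ H H T T) ≫ tensorμ A B (H ⊗ T) (H ⊗ T) ≫
        ((α_ A H T).inv ⊗ₘ (α_ B H T).inv) ≫ (e ▷ T ⊗ₘ e' ▷ T) ≫
          ((λ_ T).hom ⊗ₘ (λ_ T).hom) := by
      rw [h1]; simp [tensorHom_comp_tensorHom]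
    _ = (A ⊗ B) ◁ tensorμ H T H T ≫ (α_ (A ⊗ B) (H ⊗ H) (T ⊗ T)).inv ≫
        tensorμ A B H H ▷ (T ⊗ T) ≫ tensorμ (A ⊗ H) (B ⊗ H) T T ≫ (e ▷ T ⊗ₘ e' ▷ T) ≫
          ((λ_ T).hom ⊗ₘ (λ_ T).hom) := by
      simp only [id_tensorHom_id, Category.comp_id] at h2
      rw [← Category.assoc (tensorμ A B H H ▷ (T ⊗ T)), h2]
      simp
    _ = _ := by
      rw [← Category.assoc (tensorμ (A ⊗ H) (B ⊗ H) T T), ← tensorμ_natural_left,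
        Category.assoc, h3]
      simp only [comp_whiskerRight, Category.assoc]

/-- `T` is a module algebra over `H^*`: the coaction is multiplicative, and pairing with a product
in `H` is governed by `dualComul`. -/
theorem dualAct_mul {H : C} [BimonObj H] [IsFiniteObj H] {T : C} [MonObj T] [RightComodObj H T]
    (h : SymmetricPair H T) (hT : IsMonHom (coact H T)) :
    dual H ◁ μ[T] ≫ dualAct H T =
      dualComul H ▷ (T ⊗ T) ≫ tensorμ (dual H) (dual H) T T ≫ (dualAct H T ⊗ₘ dualAct H T) ≫
        μ[T] := by
  have h1 := dualComul_pairing H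
  rw [dualAct_eq h, ← whiskerLeft_comp_assoc, mul_leftCoact h hT]
  calc
    _ = dual H ◁ ((leftCoact H T ⊗ₘ leftCoact H T) ≫ tensorμ H T H T) ⊗≫
        (dual H ◁ μ[H] ≫ dualEv H) ▷ (T ⊗ T) ⊗≫ μ[T] := by
      rw [MonoidalCategory.tensorHom_def μ[H] μ[T]]
      calc
        _ = dual H ◁ ((leftCoact H T ⊗ₘ leftCoact H T) ≫ tensorμ H T H T) ⊗≫
            dual H ◁ μ[H] ▷ (T ⊗ T) ⊗≫ ((dual H ⊗ H) ◁ μ[T] ≫ dualEv H ▷ T) ⊗≫ 𝟙 _ := by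
          monoidal
        _ = _ := by rw [whisker_exchange]; monoidal
    _ = dual H ◁ ((leftCoact H T ⊗ₘ leftCoact H T) ≫ tensorμ H T H T) ⊗≫
        dualComul H ▷ (H ⊗ H) ▷ (T ⊗ T) ⊗≫ dualPairing H ▷ (T ⊗ T) ⊗≫ μ[T] := by
      rw [← h1]; monoidal
    _ = (dual H ◁ ((leftCoact H T ⊗ₘ leftCoact H T) ≫ tensorμ H T H T) ≫
        dualComul H ▷ ((H ⊗ H) ⊗ (T ⊗ T))) ⊗≫ dualPairing H ▷ (T ⊗ T) ⊗≫ μ[T] := by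
      monoidal
    _ = dualComul H ▷ (T ⊗ T) ≫ (dual H ⊗ dual H) ◁ (leftCoact H T ⊗ₘ leftCoact H T) ≫
        ((dual H ⊗ dual H) ◁ tensorμ H T H T ≫ (α_ _ _ _).inv ≫
        (tensorμ (dual H) (dual H) H H ≫ (dualEv H ⊗ₘ dualEv H) ≫ (λ_ (𝟙_ C)).hom) ▷ (T ⊗ T) ≫
          (λ_ (T ⊗ T)).hom) ≫ μ[T] := by
      rw [whisker_exchange, dualPairing]; monoidal
    _ = _ := by
      rw [← tensorμ_contract h, Category.assoc, ← Category.assoc ((dual H ⊗ dual H) ◁ _),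
        tensorμ_natural_right]
      simp only [Category.assoc, tensorHom_comp_tensorHom_assoc]

end InnerHom

/-! ### The Galois map `s ⊗ x ↦ s₁ ⊗ s₀ x` -/

section Galois

open HopfObj

/-- The endomorphism `t ⊗ h ↦ t₀ ⊗ f(t₁) h` of `T ⊗ H`. -/
def coactMul (H : C) [BimonObj H] (T : C) [RightComodObj H T] (f : H ⟶ H) : T ⊗ H ⟶ T ⊗ H :=
  coact H T ▷ H ≫ (α_ T H H).hom ≫ T ◁ (f ▷ H ≫ μ[H])

/-- Convolution becomes composition in reversed order, so the antipode, as convolution inverse of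
the identity, provides the inverse of `coactMul H T (𝟙 H)`. -/
theorem coactMul_comp {H : C} [BimonObj H] {T : C} [RightComodObj H T] (f g : H ⟶ H) :
    coactMul H T f ≫ coactMul H T g = coactMul H T (Δ[H] ≫ (g ⊗ₘ f) ≫ μ[H]) := by
  have h := RightComodObj.coact_comul (H := H) (T := T)
  simp only [coactMul]
  calc
    _ = coact H T ▷ H ⊗≫ (T ◁ (f ▷ H ≫ μ[H]) ≫ coact H T ▷ H) ⊗≫ T ◁ (g ▷ H ≫ μ[H]) := by
      monoidal
    _ = (coact H T ≫ coact H T ▷ H ≫ (α_ T H H).hom) ▷ H ⊗≫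
        T ◁ (H ◁ f ▷ H ⊗≫ (H ◁ μ[H] ≫ g ▷ H) ≫ μ[H]) := by
      rw [whisker_exchange]; monoidal
    _ = (coact H T ≫ coact H T ▷ H ≫ (α_ T H H).hom) ▷ H ⊗≫
        T ◁ ((H ◁ f ≫ g ▷ H) ▷ H ⊗≫ ((α_ H H H).hom ≫ H ◁ μ[H] ≫ μ[H])) := by
      rw [whisker_exchange]; monoidal
    _ = _ := by
      rw [← h, ← MonObj.mul_assoc, MonoidalCategory.tensorHom_def']; monoidal

theorem coactMul_counit (H : C) [BimonObj H] (T : C) [RightComodObj H T] :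
    coactMul H T (ε[H] ≫ η[H]) = 𝟙 _ := by
  have h := RightComodObj.coact_counit (H := H) (T := T)
  calc
    _ = (coact H T ≫ T ◁ ε[H]) ▷ H ⊗≫ T ◁ (η[H] ▷ H ≫ μ[H]) := by
      rw [coactMul]; monoidal
    _ = _ := by rw [h, MonObj.one_mul]; monoidal

theorem isIso_coactMul_id (H : C) [HopfObj H] (T : C) [RightComodObj H T] :
    IsIso (coactMul H T (𝟙 H)) := by
  refine ⟨coactMul H T 𝒮[H], ?_, ?_⟩
  · rw [coactMul_comp, tensorHom_id, HopfObj.antipode_left, coactMul_counit]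
  · rw [coactMul_comp, id_tensorHom, HopfObj.antipode_right, coactMul_counit]

/-- The morphism `T ⊗ T ⟶ H ⊗ T`, `s ⊗ x ↦ s₁ ⊗ s₀ x`. -/
def leftCan (H : C) [ComonObj H] (T : C) [MonObj T] [RightComodObj H T] : T ⊗ T ⟶ H ⊗ T :=
  leftCoact H T ▷ T ≫ (α_ H T T).hom ≫ H ◁ μ[T]

/-- In elements, `s ⊗ x ↦ s x₀ ⊗ x₁ ↦ s x₀ ⊗ S(x₁) ↦ s₀ x₀ ⊗ s₁ x₁ S(x₂) = s₀ x ⊗ s₁`, followed by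
the braiding. -/
theorem can_coactMul {H : C} [HopfObj H] {T : C} [MonObj T] [RightComodObj H T]
    (h : SymmetricPair H T) (hT : IsMonHom (coact H T)) :
    can H T ≫ T ◁ 𝒮[H] ≫ coactMul H T (𝟙 H) ≫ (β_ T H).hom = leftCan H T := by
  have h1 : μ[T] ≫ coact H T = (coact H T ⊗ₘ coact H T) ≫ tensorμ T H T H ≫ (μ[T] ⊗ₘ μ[H]) :=
    IsMonHom.mul_hom _
  have h2 : (β_ H T).hom ≫ (β_ T H).hom = 𝟙 _ := h
  have h3 : coact H T ≫ coact H T ▷ H ⊗≫ T ◁ (H ◁ 𝒮[H] ≫ μ[H]) = (ρ_ T).inv ≫ T ◁ η[H] := by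
    have h4 := RightComodObj.coact_comul (H := H) (T := T)
    calc
      _ = (coact H T ≫ coact H T ▷ H ≫ (α_ T H H).hom) ≫ T ◁ (H ◁ 𝒮[H] ≫ μ[H]) := by monoidal
      _ = coact H T ≫ T ◁ (Δ[H] ≫ H ◁ 𝒮[H] ≫ μ[H]) := by rw [← h4]; monoidal
      _ = (coact H T ≫ T ◁ ε[H]) ≫ T ◁ η[H] := by rw [HopfObj.antipode_right]; simp
      _ = _ := by rw [RightComodObj.coact_counit]
  have h5 : can H T ≫ T ◁ 𝒮[H] ≫ coactMul H T (𝟙 H) =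
      coact H T ▷ T ⊗≫ T ◁ (β_ H T).hom ⊗≫ μ[T] ▷ H := by
    calc
      _ = T ◁ coact H T ⊗≫ (μ[T] ▷ H ≫ T ◁ 𝒮[H]) ⊗≫ coact H T ▷ H ⊗≫ T ◁ μ[H] := by
        simp only [can, coactMul]; monoidal
      _ = T ◁ coact H T ⊗≫ (T ⊗ T) ◁ 𝒮[H] ⊗≫ (μ[T] ≫ coact H T) ▷ H ⊗≫ T ◁ μ[H] := by
        rw [← whisker_exchange]; monoidal
      _ = T ◁ coact H T ⊗≫ (T ⊗ T) ◁ 𝒮[H] ⊗≫ (T ◁ coact H T ≫ coact H T ▷ (T ⊗ H)) ▷ H ⊗≫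
          T ◁ (β_ H T).hom ▷ (H ⊗ H) ⊗≫ μ[T] ▷ (H ⊗ H ⊗ H) ⊗≫
          T ◁ (μ[H] ▷ H ≫ μ[H]) := by
        rw [h1, MonoidalCategory.tensorHom_def' (coact H T), MonoidalCategory.tensorHom_def,
          tensorμ]
        monoidal
      _ = T ◁ coact H T ⊗≫ ((T ⊗ T) ◁ 𝒮[H] ≫ (T ◁ coact H T) ▷ H) ⊗≫
          coact H T ▷ (T ⊗ H ⊗ H) ⊗≫
          T ◁ (β_ H T).hom ▷ (H ⊗ H) ⊗≫ μ[T] ▷ (H ⊗ H ⊗ H) ⊗≫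
          T ◁ (H ◁ μ[H] ≫ μ[H]) := by
        rw [MonObj.mul_assoc]; monoidal
      _ = T ◁ (coact H T ≫ coact H T ▷ H) ⊗≫ T ◁ T ◁ H ◁ 𝒮[H] ⊗≫ coact H T ▷ (T ⊗ H ⊗ H) ⊗≫
          T ◁ (β_ H T).hom ▷ (H ⊗ H) ⊗≫ (μ[T] ▷ (H ⊗ H ⊗ H) ≫ T ◁ H ◁ μ[H]) ⊗≫ T ◁ μ[H] := by
        rw [whisker_exchange]; monoidal
      _ = T ◁ (coact H T ≫ coact H T ▷ H) ⊗≫ T ◁ T ◁ H ◁ 𝒮[H] ⊗≫ coact H T ▷ (T ⊗ H ⊗ H) ⊗≫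
          T ◁ ((β_ H T).hom ▷ (H ⊗ H) ≫ (T ⊗ H) ◁ μ[H]) ⊗≫ μ[T] ▷ (H ⊗ H) ⊗≫ T ◁ μ[H] := by
        rw [← whisker_exchange]; monoidal
      _ = T ◁ (coact H T ≫ coact H T ▷ H) ⊗≫ T ◁ T ◁ H ◁ 𝒮[H] ⊗≫
          (coact H T ▷ (T ⊗ H ⊗ H) ≫ (T ⊗ H) ◁ T ◁ μ[H]) ⊗≫
          T ◁ (β_ H T).hom ▷ H ⊗≫ μ[T] ▷ (H ⊗ H) ⊗≫ T ◁ μ[H] := by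
        rw [← whisker_exchange]; monoidal
      _ = T ◁ (coact H T ≫ coact H T ▷ H ⊗≫ T ◁ (H ◁ 𝒮[H] ≫ μ[H])) ≫ coact H T ▷ (T ⊗ H) ⊗≫
          T ◁ (β_ H T).hom ▷ H ⊗≫ μ[T] ▷ (H ⊗ H) ⊗≫ T ◁ μ[H] := by
        rw [← whisker_exchange]; monoidal
      _ = 𝟙 _ ⊗≫ (T ◁ (T ◁ η[H]) ≫ coact H T ▷ (T ⊗ H)) ⊗≫
          T ◁ (β_ H T).hom ▷ H ⊗≫ μ[T] ▷ (H ⊗ H) ⊗≫ T ◁ μ[H] := by rw [h3]; monoidal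
      _ = coact H T ▷ T ⊗≫ T ◁ ((H ⊗ T) ◁ η[H] ≫ (β_ H T).hom ▷ H) ⊗≫
          (μ[T] ▷ (H ⊗ H) ≫ T ◁ μ[H]) := by
        rw [whisker_exchange]; monoidal
      _ = coact H T ▷ T ⊗≫ T ◁ (β_ H T).hom ⊗≫ ((T ⊗ T) ◁ (H ◁ η[H] ≫ μ[H]) ≫ μ[T] ▷ H) := by
        rw [whisker_exchange, ← whisker_exchange μ[T]]; monoidal
      _ = _ := by rw [MonObj.mul_one]; monoidal
  calc
    _ = (can H T ≫ T ◁ 𝒮[H] ≫ coactMul H T (𝟙 H)) ≫ (β_ T H).hom := by simp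
    _ = coact H T ▷ T ⊗≫ T ◁ (β_ H T).hom ⊗≫ (μ[T] ▷ H ≫ (β_ T H).hom) := by
      rw [h5]; monoidal
    _ = coact H T ▷ T ⊗≫ T ◁ ((β_ H T).hom ≫ (β_ T H).hom) ⊗≫ (β_ T H).hom ▷ T ⊗≫
        H ◁ μ[T] := by
      rw [BraidedCategory.braiding_naturality_left, BraidedCategory.braiding_tensor_left_hom]
      monoidal
    _ = _ := by rw [h2, leftCan, leftCoact]; monoidal

theorem isIso_leftCan {H : C} [HopfObj H] [IsCommMonObj H] {T : C} [MonObj T]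
    [RightComodObj H T] (h : SymmetricPair H T) (hT : IsGaloisObj H T) :
    IsIso (leftCan H T) := by
  have hS : 𝒮[H] ≫ 𝒮[H] = 𝟙 H := HopfObj.antipode_antipode H (IsCommMonObj.mul_comm H)
  have : IsIso 𝒮[H] := ⟨𝒮[H], hS, hS⟩
  have := hT.isIso_can
  have := isIso_coactMul_id H T
  rw [← can_coactMul h hT.isMonHom_coact]
  infer_instance

theorem leftCan_mul {H : C} [ComonObj H] {T : C} [MonObj T] [RightComodObj H T] :
    (α_ T T T).hom ≫ T ◁ μ[T] ≫ leftCan H T = leftCan H T ▷ T ≫ (α_ H T T).hom ≫ H ◁ μ[T] := by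
  calc
    _ = 𝟙 _ ⊗≫ (T ◁ μ[T] ≫ leftCoact H T ▷ T) ⊗≫ H ◁ μ[T] := by
      rw [leftCan]; monoidal
    _ = leftCoact H T ▷ T ▷ T ⊗≫ H ◁ ((α_ T T T).hom ≫ T ◁ μ[T] ≫ μ[T]) := by
      rw [whisker_exchange]; monoidal
    _ = _ := by rw [← MonObj.mul_assoc, leftCan]; monoidal

/-! ### The translation morphism -/

variable {H : C} [ComonObj H] {T : C} [MonObj T] [RightComodObj H T] [IsIso (leftCan H T)]

variable (H T) in
/-- The translation morphism `H ⟶ T ⊗ T`, `h ↦ (s ⊗ x ↦ s₁ ⊗ s₀ x)⁻¹ (h ⊗ 1)`. -/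
def translation : H ⟶ T ⊗ T := (ρ_ H).inv ≫ H ◁ η[T] ≫ inv (leftCan H T)

theorem translation_leftCan : translation H T ≫ leftCan H T = (ρ_ H).inv ≫ H ◁ η[T] := by
  simp [translation]

/-- By right `T`-linearity (`leftCan_mul`), the Galois map sends both sides to `t₁ ⊗ t₀`. -/
theorem leftCoact_translation :
    leftCoact H T ≫ translation H T ▷ T ≫ (α_ T T T).hom ≫ T ◁ μ[T] = (ρ_ T).inv ≫ T ◁ η[T] := by
  rw [← cancel_mono (leftCan H T)]
  simp only [Category.assoc]
  rw [leftCan_mul]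
  calc
    _ = leftCoact H T ≫ (translation H T ≫ leftCan H T) ▷ T ≫ (α_ H T T).hom ≫ H ◁ μ[T] := by simp
    _ = leftCoact H T ⊗≫ H ◁ (η[T] ▷ T ≫ μ[T]) := by rw [translation_leftCan]; monoidal
    _ = leftCoact H T ⊗≫ H ◁ (T ◁ η[T] ≫ μ[T]) := by
      rw [MonObj.one_mul, MonObj.mul_one]; monoidal
    _ = 𝟙 _ ⊗≫ (leftCoact H T ▷ 𝟙_ C ≫ (H ⊗ T) ◁ η[T]) ⊗≫ H ◁ μ[T] := by monoidal
    _ = _ := by rw [← whisker_exchange, leftCan]; monoidal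

end Galois

section SmashAlgebra

variable [MonoidalClosed C]

/-! ### The action of `T # H^*` on `T` -/

/-- The action `(t # a) ⊗ s ↦ t (a · s)` of `T # H^*` on `T`. -/
def smashAct (H : C) [ComonObj H] (T : C) [MonObj T] [RightComodObj H T] :
    (T ⊗ dual H) ⊗ T ⟶ T :=
  (α_ T (dual H) T).hom ≫ T ◁ dualAct H T ≫ μ[T]

theorem smashOne_smashAct {H : C} [ComonObj H] {T : C} [MonObj T] [RightComodObj H T]
    (h : SymmetricPair H T) : smashOne H T ▷ T ≫ smashAct H T = (λ_ T).hom := by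
  calc
    _ = 𝟙 _ ⊗≫ η[T] ▷ T ⊗≫ T ◁ (dualOne H ▷ T ≫ dualAct H T) ≫ μ[T] := by
      rw [smashOne, smashAct, MonoidalCategory.tensorHom_def]; monoidal
    _ = 𝟙 _ ⊗≫ (η[T] ▷ T ≫ μ[T]) := by rw [dualOne_dualAct h]; monoidal
    _ = _ := by rw [MonObj.one_mul]; monoidal

/-- In `a · (t' (b · s))` the module algebra law splits `a` over the product, and `a₂ · (b · s) =
(a₂ b) · s`. -/
theorem smashMul_smashAct {H : C} [BimonObj H] [IsFiniteObj H] {T : C} [MonObj T]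
    [RightComodObj H T] (hc : Δ[H] ≫ (β_ H H).hom = Δ[H]) (h : SymmetricPair H T)
    (hT : IsMonHom (coact H T)) :
    smashMul H T ▷ T ≫ smashAct H T =
      (α_ (T ⊗ dual H) (T ⊗ dual H) T).hom ≫ (T ⊗ dual H) ◁ smashAct H T ≫ smashAct H T := by
  have h1 : tensorμ (dual H) (dual H) T (dual H) ▷ T ≫ (α_ _ _ _).hom ≫
      (dual H ⊗ T) ◁ ((α_ (dual H) (dual H) T).hom ≫ dual H ◁ dualAct H T) =
      (α_ (dual H ⊗ dual H) (T ⊗ dual H) T).hom ≫ (dual H ⊗ dual H) ◁ (α_ T (dual H) T).hom ≫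
        (dual H ⊗ dual H) ◁ (T ◁ dualAct H T) ≫ tensorμ (dual H) (dual H) T T := by
    calc
      _ = 𝟙 _ ⊗≫ dual H ◁ ((β_ (dual H) T).hom ▷ (dual H ⊗ T) ≫ (T ⊗ dual H) ◁ dualAct H T)
          ⊗≫ 𝟙 _ := by simp only [tensorμ]; monoidal
      _ = _ := by rw [← whisker_exchange, tensorμ]; monoidal
  calc
    _ = 𝟙 _ ⊗≫ T ◁ (dualComul H ▷ (T ⊗ dual H) ≫ tensorμ (dual H) (dual H) T (dual H) ≫
          (dualAct H T ⊗ₘ dualMul H)) ▷ T ⊗≫ (μ[T] ▷ (dual H ⊗ T) ≫ T ◁ dualAct H T) ≫ μ[T] := by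
      simp only [smashMul, smashAct]; monoidal
    _ = 𝟙 _ ⊗≫ T ◁ ((dualComul H ▷ (T ⊗ dual H) ≫ tensorμ (dual H) (dual H) T (dual H) ≫
          (dual H ⊗ T) ◁ dualMul H ≫ dualAct H T ▷ dual H)) ▷ T ⊗≫
          (T ⊗ T) ◁ dualAct H T ⊗≫ ((α_ T T T).inv ≫ μ[T] ▷ T ≫ μ[T]) := by
      rw [← whisker_exchange, MonoidalCategory.tensorHom_def']; monoidal
    _ = 𝟙 _ ⊗≫ T ◁ ((dualComul H ▷ (T ⊗ dual H) ≫ tensorμ (dual H) (dual H) T (dual H)) ▷ T ⊗≫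
          (dual H ⊗ T) ◁ dualMul H ▷ T ⊗≫ (dualAct H T ▷ (dual H ⊗ T) ≫
          T ◁ dualAct H T) ≫ μ[T]) ≫ μ[T] := by
      rw [MonObj.mul_assoc]; monoidal
    _ = 𝟙 _ ⊗≫ T ◁ ((dualComul H ▷ (T ⊗ dual H) ≫ tensorμ (dual H) (dual H) T (dual H)) ▷ T ⊗≫
          (dual H ⊗ T) ◁ (dualMul H ▷ T ≫ dualAct H T) ⊗≫ dualAct H T ▷ T ≫ μ[T]) ≫ μ[T] := by
      rw [← whisker_exchange]; monoidal
    _ = 𝟙 _ ⊗≫ T ◁ (dualComul H ▷ (T ⊗ dual H) ▷ T ⊗≫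
          (tensorμ (dual H) (dual H) T (dual H) ▷ T ≫ (α_ _ _ _).hom ≫
            (dual H ⊗ T) ◁ ((α_ (dual H) (dual H) T).hom ≫ dual H ◁ dualAct H T)) ⊗≫
          ((dual H ⊗ T) ◁ dualAct H T ≫ dualAct H T ▷ T) ≫ μ[T]) ≫ μ[T] := by
      rw [dualMul_dualAct hc h]; monoidal
    _ = 𝟙 _ ⊗≫ T ◁ ((dualComul H ▷ (T ⊗ dual H ⊗ T) ≫
          (dual H ⊗ dual H) ◁ (T ◁ dualAct H T)) ≫ tensorμ (dual H) (dual H) T T ≫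
          (dualAct H T ⊗ₘ dualAct H T) ≫ μ[T]) ≫ μ[T] := by
      rw [h1, MonoidalCategory.tensorHom_def']; monoidal
    _ = 𝟙 _ ⊗≫ T ◁ (dual H ◁ (T ◁ dualAct H T) ≫ dualComul H ▷ (T ⊗ T) ≫
          tensorμ (dual H) (dual H) T T ≫ (dualAct H T ⊗ₘ dualAct H T) ≫ μ[T]) ≫ μ[T] := by
      rw [← whisker_exchange]; monoidal
    _ = _ := by rw [← dualAct_mul h hT]; simp only [smashAct]; monoidal

/-- The morphism `(Y ⊗ T ⊗ H^*) ⊗ T ⟶ Y ⊗ T` that acts with `T # H^*` on `T`. -/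
def whiskerSmashAct (H : C) [ComonObj H] (T : C) [MonObj T] [RightComodObj H T] (Y : C) :
    (Y ⊗ T ⊗ dual H) ⊗ T ⟶ Y ⊗ T :=
  (α_ Y (T ⊗ dual H) T).hom ≫ Y ◁ smashAct H T

/-- If `u` corresponds to `g : Z ⊗ H ⟶ Y ⊗ T`, then acting through `u` is `z ⊗ s ↦ g(z ⊗ s₁) s₀`. -/
theorem whiskerSmashAct_eq {H : C} [ComonObj H] {T : C} [MonObj T] [RightComodObj H T]
    (h : SymmetricPair H T) (Y : C) {Z : C} (u : Z ⟶ (Y ⊗ T) ⊗ dual H) :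
    (u ≫ (α_ Y T (dual H)).hom) ▷ T ≫ whiskerSmashAct H T Y =
      Z ◁ leftCoact H T ≫ (α_ Z H T).inv ≫
        (u ▷ H ≫ (α_ (Y ⊗ T) (dual H) H).hom ≫ (Y ⊗ T) ◁ dualEv H ≫ (ρ_ (Y ⊗ T)).hom) ▷ T ≫
          (α_ Y T T).hom ≫ Y ◁ μ[T] := by
  calc
    _ = (u ▷ T ≫ ((Y ⊗ T) ⊗ dual H) ◁ leftCoact H T) ⊗≫ (Y ⊗ T) ◁ dualEv H ▷ T ⊗≫
        Y ◁ μ[T] := by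
      rw [whiskerSmashAct, smashAct, dualAct_eq h]; monoidal
    _ = _ := by rw [← whisker_exchange]; monoidal

/-- Writing the translation morphism as `h ↦ h' ⊗ h''`, the assignment `φ ↦ (z ⊗ h ↦ φ(z ⊗ h') h'')`
inverts `g ↦ (z ⊗ s ↦ g(z ⊗ s₁) s₀)`; `hR` and `hL` are the two composites. -/
theorem isIso_lam_whiskerSmashAct {H : C} [ComonObj H] [IsFiniteObj H] {T : C} [MonObj T]
    [RightComodObj H T] [IsIso (leftCan H T)] (h : SymmetricPair H T) (Y : C) :
    IsIso (lam (whiskerSmashAct H T Y)) := by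
  let _ := finiteExactPairing H
  have hR : ∀ {Z : C} (φ : Z ⊗ T ⟶ Y ⊗ T),
      Z ◁ leftCoact H T ≫ (α_ Z H T).inv ≫
        (Z ◁ translation H T ≫ (α_ Z T T).inv ≫ φ ▷ T ≫ (α_ Y T T).hom ≫ Y ◁ μ[T]) ▷ T ≫
          (α_ Y T T).hom ≫ Y ◁ μ[T] = φ := by
    intro Z φ
    calc
      _ = Z ◁ (leftCoact H T ≫ translation H T ▷ T) ⊗≫ φ ▷ T ▷ T ⊗≫
          Y ◁ (μ[T] ▷ T ≫ μ[T]) := by monoidal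
      _ = Z ◁ (leftCoact H T ≫ translation H T ▷ T) ⊗≫ (φ ▷ (T ⊗ T) ≫ (Y ⊗ T) ◁ μ[T]) ⊗≫
          Y ◁ μ[T] := by rw [MonObj.mul_assoc]; monoidal
      _ = Z ◁ (leftCoact H T ≫ translation H T ▷ T ≫ (α_ T T T).hom ≫ T ◁ μ[T]) ⊗≫ φ ▷ T ⊗≫
          Y ◁ μ[T] := by rw [← whisker_exchange]; monoidal
      _ = 𝟙 _ ⊗≫ ((Z ⊗ T) ◁ η[T] ≫ φ ▷ T) ⊗≫ Y ◁ μ[T] := by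
        rw [leftCoact_translation]; monoidal
      _ = φ ⊗≫ Y ◁ (T ◁ η[T] ≫ μ[T]) := by rw [whisker_exchange]; monoidal
      _ = _ := by rw [MonObj.mul_one]; monoidal
  have hL : ∀ {Z : C} (g : Z ⊗ H ⟶ Y ⊗ T),
      Z ◁ translation H T ≫ (α_ Z T T).inv ≫
        (Z ◁ leftCoact H T ≫ (α_ Z H T).inv ≫ g ▷ T ≫ (α_ Y T T).hom ≫ Y ◁ μ[T]) ▷ T ≫
          (α_ Y T T).hom ≫ Y ◁ μ[T] = g := by
    intro Z g
    calc
      _ = Z ◁ (translation H T ≫ leftCoact H T ▷ T) ⊗≫ g ▷ T ▷ T ⊗≫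
          Y ◁ (μ[T] ▷ T ≫ μ[T]) := by monoidal
      _ = Z ◁ (translation H T ≫ leftCoact H T ▷ T) ⊗≫ (g ▷ (T ⊗ T) ≫ (Y ⊗ T) ◁ μ[T]) ⊗≫
          Y ◁ μ[T] := by rw [MonObj.mul_assoc]; monoidal
      _ = Z ◁ (translation H T ≫ leftCan H T) ⊗≫ g ▷ T ⊗≫ Y ◁ μ[T] := by
        rw [← whisker_exchange, leftCan]; monoidal
      _ = 𝟙 _ ⊗≫ ((Z ⊗ H) ◁ η[T] ≫ g ▷ T) ⊗≫ Y ◁ μ[T] := by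
        rw [translation_leftCan]; monoidal
      _ = g ⊗≫ Y ◁ (T ◁ η[T] ≫ μ[T]) := by rw [whisker_exchange]; monoidal
      _ = _ := by rw [MonObj.mul_one]; monoidal
  have hE : ∀ {Z : C} (g : Z ⊗ H ⟶ Y ⊗ T),
      tensorRightHomEquiv Z H (dual H) (Y ⊗ T) g ▷ H ≫ (α_ (Y ⊗ T) (dual H) H).hom ≫
        (Y ⊗ T) ◁ dualEv H ≫ (ρ_ (Y ⊗ T)).hom = g :=
    fun g => (tensorRightHomEquiv _ H (dual H) _).symm_apply_apply g
  apply isIso_lam_of_represents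
  · intro Z φ
    refine ⟨tensorRightHomEquiv Z H (dual H) (Y ⊗ T) (Z ◁ translation H T ≫ (α_ Z T T).inv ≫
      φ ▷ T ≫ (α_ Y T T).hom ≫ Y ◁ μ[T]) ≫ (α_ Y T (dual H)).hom, ?_⟩
    rw [whiskerSmashAct_eq h, hE, hR]
  · intro Z u w huw
    obtain ⟨u, rfl⟩ : ∃ u', u = u' ≫ (α_ Y T (dual H)).hom :=
      ⟨u ≫ (α_ Y T (dual H)).inv, by simp⟩
    obtain ⟨w, rfl⟩ : ∃ w', w = w' ≫ (α_ Y T (dual H)).hom :=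
      ⟨w ≫ (α_ Y T (dual H)).inv, by simp⟩
    rw [whiskerSmashAct_eq h, whiskerSmashAct_eq h] at huw
    congr 1
    apply (tensorRightHomEquiv _ H (dual H) _).symm.injective
    change u ▷ H ≫ (α_ (Y ⊗ T) (dual H) H).hom ≫ (Y ⊗ T) ◁ dualEv H ≫ (ρ_ (Y ⊗ T)).hom =
      w ▷ H ≫ (α_ (Y ⊗ T) (dual H) H).hom ≫ (Y ⊗ T) ◁ dualEv H ≫ (ρ_ (Y ⊗ T)).hom
    rw [← hL (u ▷ H ≫ _), huw, hL]

theorem isIso_lam_smashAct {H : C} [ComonObj H] [IsFiniteObj H] {T : C} [MonObj T]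
    [RightComodObj H T] [IsIso (leftCan H T)] (h : SymmetricPair H T) :
    IsIso (lam (smashAct H T)) := by
  have := isIso_lam_whiskerSmashAct (H := H) (T := T) h (𝟙_ C)
  have e : lam (smashAct H T) = (λ_ (T ⊗ dual H)).inv ≫ lam (whiskerSmashAct H T (𝟙_ C)) ≫
      (ihom T).map (λ_ T).hom := by
    rw [lam_comp, comp_lam, whiskerSmashAct]
    congr 1
    monoidal
  rw [e]
  infer_instance

/-- The identifications of `[T, Y ⊗ T]` and `[T, (T ⊗ Y) ⊗ T]` with tensor products turn the
comparison into an associator. -/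
theorem isIso_tensorInnerHom {H : C} [ComonObj H] [IsFiniteObj H] {T : C} [MonObj T]
    [RightComodObj H T] [IsIso (leftCan H T)] (h : SymmetricPair H T) (Y : C) :
    IsIso (tensorInnerHom T T (Y ⊗ T)) := by
  have := isIso_lam_whiskerSmashAct (H := H) (T := T) h Y
  have := isIso_lam_whiskerSmashAct (H := H) (T := T) h (T ⊗ Y)
  have e : T ◁ lam (whiskerSmashAct H T Y) ≫ tensorInnerHom T T (Y ⊗ T) =
      (α_ T Y (T ⊗ dual H)).inv ≫ lam (whiskerSmashAct H T (T ⊗ Y)) ≫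
        (ihom T).map (α_ T Y T).hom := by
    rw [lam_comp, comp_lam, tensorInnerHom, comp_lam]
    congr 1
    calc
      _ = (α_ T (Y ⊗ T ⊗ dual H) T).hom ≫
          T ◁ (lam (whiskerSmashAct H T Y) ▷ T ≫ innerEv T (Y ⊗ T)) := by monoidal
      _ = _ := by rw [lam_ev, whiskerSmashAct, whiskerSmashAct]; monoidal
  have h2 : IsIso (T ◁ lam (whiskerSmashAct H T Y) ≫ tensorInnerHom T T (Y ⊗ T)) := by
    rw [e]; infer_instance
  exact IsIso.of_isIso_comp_left (T ◁ lam (whiskerSmashAct H T Y)) _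

/-- A faithfully flat Galois object over a finite transparent Hopf algebra is finite. -/
theorem isFiniteObj_of_galois [HasEqualizers C] {H : C} [ComonObj H] [IsFiniteObj H] {T : C}
    [MonObj T] [RightComodObj H T] [IsIso (leftCan H T)] (h : SymmetricPair H T)
    (hT : IsFaithfullyFlat T) : IsFiniteObj T := by
  have := hT.isIso_tensorInnerHom_unit T
    (isIso_tensorInnerHom_of_iso T T (λ_ T) (isIso_tensorInnerHom h (𝟙_ C)))
    (isIso_tensorInnerHom h T)
  constructor
  rw [toEnd, ← tensorInnerHom_unit]
  infer_instance

/-- The smash product `T # H^*` is an algebra. -/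
@[reducible]
def smashMonObj {H : C} [BimonObj H] [IsFiniteObj H] {T : C} [MonObj T]
    [RightComodObj H T] [IsIso (leftCan H T)] (hc : Δ[H] ≫ (β_ H H).hom = Δ[H])
    (h : SymmetricPair H T) (hT : IsMonHom (coact H T)) : MonObj (T ⊗ dual H) :=
  -- The action on `T` is faithful, so each axiom may be checked after acting on `T`.
  have := isIso_lam_smashAct (H := H) (T := T) h
  have h1 := smashOne_smashAct (H := H) (T := T) h
  have h2 := smashMul_smashAct hc h hT
  { one := smashOne H T
    mul := smashMul H T
    one_mul := by
      apply eq_of_isIso_lam (smashAct H T)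
      rw [comp_whiskerRight, Category.assoc, h2]
      calc
        _ = 𝟙 _ ⊗≫ (smashOne H T ▷ ((T ⊗ dual H) ⊗ T) ≫ (T ⊗ dual H) ◁ smashAct H T) ≫
            smashAct H T := by monoidal
        _ = 𝟙 _ ⊗≫ smashAct H T ⊗≫ (smashOne H T ▷ T ≫ smashAct H T) := by
          rw [← whisker_exchange]; monoidal
        _ = _ := by rw [h1]; monoidal
    mul_one := by
      apply eq_of_isIso_lam (smashAct H T)
      rw [comp_whiskerRight, Category.assoc, h2]
      calc
        _ = 𝟙 _ ⊗≫ (T ⊗ dual H) ◁ (smashOne H T ▷ T ≫ smashAct H T) ≫ smashAct H T := by monoidal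
        _ = _ := by rw [h1]; monoidal
    mul_assoc := by
      apply eq_of_isIso_lam (smashAct H T)
      simp only [comp_whiskerRight, Category.assoc, h2]
      calc
        _ = 𝟙 _ ⊗≫ (smashMul H T ▷ ((T ⊗ dual H) ⊗ T) ≫ (T ⊗ dual H) ◁ smashAct H T) ≫
            smashAct H T := by monoidal
        _ = 𝟙 _ ⊗≫ ((T ⊗ dual H) ⊗ (T ⊗ dual H)) ◁ smashAct H T ⊗≫
            (smashMul H T ▷ T ≫ smashAct H T) := by
          rw [← whisker_exchange]; monoidal
        _ = 𝟙 _ ⊗≫ (T ⊗ dual H) ◁ ((α_ (T ⊗ dual H) (T ⊗ dual H) T).hom ≫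
            (T ⊗ dual H) ◁ smashAct H T ≫ smashAct H T) ≫ smashAct H T := by
          rw [h2]; monoidal
        _ = 𝟙 _ ⊗≫ (T ⊗ dual H) ◁ (smashMul H T ▷ T ≫ smashAct H T) ≫ smashAct H T := by
          rw [h2]
        _ = _ := by monoidal }

end SmashAlgebra

section Azumaya

variable [MonoidalClosed C]

/-! ### Endomorphism algebras of finite objects -/

theorem isIso_lam_of_iso {X X' A A' B B' : C} (x : X ≅ X') (a : A ≅ A') (b : B ≅ B')
    {f : X ⊗ A ⟶ B} {f' : X' ⊗ A' ⟶ B'} (h : f ≫ b.hom = (x.hom ⊗ₘ a.hom) ≫ f')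
    [IsIso (lam f')] : IsIso (lam f) := by
  have hf : f = x.hom ▷ A ≫ X' ◁ a.hom ≫ f' ≫ b.inv := by
    rw [← cancel_mono b.hom, h, MonoidalCategory.tensorHom_def]; simp
  have key : ∀ {Z : C} (u : Z ⟶ X), u ▷ A ≫ f =
      Z ◁ a.hom ≫ ((u ≫ x.hom) ▷ A' ≫ f') ≫ b.inv := by
    intro Z u
    rw [hf, ← comp_whiskerRight_assoc, ← whisker_exchange_assoc, Category.assoc]
  apply isIso_lam_of_represents
  · intro Z φ
    obtain ⟨u, hu⟩ := exists_of_isIso_lam f' (Z ◁ a.inv ≫ φ ≫ b.hom)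
    refine ⟨u ≫ x.inv, ?_⟩
    rw [key, Category.assoc u, x.inv_hom_id, Category.comp_id, hu]
    simp
  · intro Z u w huw
    rw [key, key, cancel_epi, cancel_mono] at huw
    rw [← cancel_mono x.hom]
    exact eq_of_isIso_lam f' huw

/-- The multiplication `(p ⊗ f) (q ⊗ g) = p f(q) ⊗ g` of `P ⊗ P^*`. -/
def endMul (P : C) : (P ⊗ dual P) ⊗ (P ⊗ dual P) ⟶ P ⊗ dual P :=
  𝟙 _ ⊗≫ P ◁ dualEv P ▷ dual P ⊗≫ 𝟙 _

/-- The action `p ⊗ f ⊗ q ↦ p f(q)` of `P ⊗ P^*` on `P`. -/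
def endAct (P : C) : (P ⊗ dual P) ⊗ P ⟶ P :=
  (α_ P (dual P) P).hom ≫ P ◁ dualEv P ≫ (ρ_ P).hom

theorem endMul_endAct (P : C) :
    endMul P ▷ P ≫ endAct P =
      (α_ (P ⊗ dual P) (P ⊗ dual P) P).hom ≫ (P ⊗ dual P) ◁ endAct P ≫ endAct P := by
  calc
    _ = 𝟙 _ ⊗≫ P ◁ (dualEv P ▷ (dual P ⊗ P) ≫ 𝟙_ C ◁ dualEv P) ⊗≫ 𝟙 _ := by
      rw [endMul, endAct]; monoidal
    _ = _ := by rw [← whisker_exchange, endAct]; monoidal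

/-- The pairing `f ⊗ q ⊗ r ⊗ k ↦ f(r) k(q)`. -/
def endPairing (P : C) : (dual P ⊗ P) ⊗ (P ⊗ dual P) ⟶ 𝟙_ C :=
  𝟙 _ ⊗≫ dual P ◁ (β_ P (P ⊗ dual P)).hom ⊗≫ (dual P ⊗ P) ◁ dualEv P ⊗≫ dualEv P

theorem braiding_endPairing (P : C) :
    (β_ P (dual P)).hom ▷ (P ⊗ dual P) ≫ endPairing P =
      𝟙 _ ⊗≫ P ◁ (dualEv P ▷ dual P) ⊗≫ ((β_ P (dual P)).hom ≫ dualEv P) := by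
  calc
    _ = 𝟙 _ ⊗≫ ((α_ P (dual P) P).inv ≫ (β_ P (dual P)).hom ▷ P ≫ (α_ (dual P) P P).hom ≫
          dual P ◁ (β_ P P).hom ≫ (α_ (dual P) P P).inv) ▷ dual P ⊗≫
          (dual P ⊗ P) ◁ (β_ P (dual P)).hom ⊗≫
          ((dual P ⊗ P) ◁ dualEv P ≫ dualEv P ▷ 𝟙_ C) ⊗≫ 𝟙 _ := by
      rw [endPairing, BraidedCategory.braiding_tensor_right_hom]; monoidal
    _ = 𝟙 _ ⊗≫ (β_ P (dual P ⊗ P)).hom ▷ dual P ⊗≫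
          ((dual P ⊗ P) ◁ (β_ P (dual P)).hom ≫ dualEv P ▷ (dual P ⊗ P)) ⊗≫ dualEv P := by
      rw [whisker_exchange, ← BraidedCategory.braiding_tensor_right_hom]; monoidal
    _ = 𝟙 _ ⊗≫ ((β_ P (dual P ⊗ P)).hom ≫ dualEv P ▷ P) ▷ dual P ⊗≫
          ((β_ P (dual P)).hom ≫ dualEv P) := by
      rw [whisker_exchange]; monoidal
    _ = _ := by
      rw [← BraidedCategory.braiding_naturality_right, braiding_tensorUnit_right]; monoidal

/-- The permutation `p ⊗ f ⊗ q ⊗ g ↦ p ⊗ g ⊗ q ⊗ f`. -/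
def endShuffle (P : C) : (P ⊗ dual P) ⊗ (P ⊗ dual P) ≅ (P ⊗ dual P) ⊗ (P ⊗ dual P) :=
  α_ P (dual P) (P ⊗ dual P) ≪≫ whiskerLeftIso P ((α_ (dual P) P (dual P)).symm ≪≫
    (β_ (dual P) (dual P ⊗ P)).symm ≪≫ whiskerLeftIso (dual P) (β_ P (dual P)).symm) ≪≫
    (α_ P (dual P) (P ⊗ dual P)).symm

/-- Up to braidings, `p ⊗ f` and `q ⊗ g` act on `r ⊗ k` by `(p ⊗ f)(r ⊗ k)(q ⊗ g) = f(r) k(q) (p ⊗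
g)`. After the shuffle this is evaluation of `q ⊗ f` on `r ⊗ k`, with `p ⊗ g` as a spectator. -/
theorem endShuffle_inv_endMul (P : C) :
    (endShuffle P).inv ▷ (P ⊗ dual P) ≫ (α_ (P ⊗ dual P) (P ⊗ dual P) (P ⊗ dual P)).hom ≫
        (P ⊗ dual P) ◁ ((β_ (P ⊗ dual P) (P ⊗ dual P)).hom ≫ endMul P) ≫ endMul P =
      (α_ (P ⊗ dual P) (P ⊗ dual P) (P ⊗ dual P)).hom ≫
        (P ⊗ dual P) ◁ (𝟙 _ ⊗≫ P ◁ (dualEv P ▷ dual P) ⊗≫ ((β_ P (dual P)).hom ≫ dualEv P)) ≫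
          (ρ_ (P ⊗ dual P)).hom := by
  have h := BraidedCategory.braiding_naturality_right (dual P) (endPairing P)
  rw [braiding_tensorUnit_right, BraidedCategory.braiding_tensor_right_hom] at h
  calc
    _ = 𝟙 _ ⊗≫ P ◁ dual P ◁ (β_ P (dual P)).hom ▷ (P ⊗ dual P) ⊗≫
          P ◁ (((α_ _ _ _).inv ≫ (β_ (dual P) (dual P ⊗ P)).hom ▷ (P ⊗ dual P) ≫ (α_ _ _ _).hom ≫
            (dual P ⊗ P) ◁ (β_ (dual P) (P ⊗ dual P)).hom ≫ (α_ _ _ _).inv) ≫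
              endPairing P ▷ dual P) ⊗≫ 𝟙 _ := by
      rw [BraidedCategory.braiding_tensor_left_hom P]
      simp only [endMul, endShuffle, endPairing, Iso.trans_inv, whiskerLeftIso_inv, Iso.symm_inv]
      monoidal
    _ = 𝟙 _ ⊗≫ P ◁ dual P ◁ ((β_ P (dual P)).hom ▷ (P ⊗ dual P) ≫ endPairing P) ⊗≫ 𝟙 _ := by
      rw [← h]; monoidal
    _ = _ := by rw [braiding_endPairing]; monoidal

/-- `P ⊗ P^*` is its own dual under `q ⊗ f ⊗ r ⊗ k ↦ f(r) k(q)`, so evaluation represents; the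
shuffle transfers this to the Azumaya action. -/
theorem isIso_lam_endMul (P : C) [IsFiniteObj P] :
    IsIso (lam ((α_ (P ⊗ dual P) (P ⊗ dual P) (P ⊗ dual P)).hom ≫
      (P ⊗ dual P) ◁ ((β_ (P ⊗ dual P) (P ⊗ dual P)).hom ≫ endMul P) ≫ endMul P)) := by
  let _ := finiteExactPairing P
  let _ := BraidedCategory.exactPairing_swap P (dual P)
  have h := isIso_lam_evaluation (P ⊗ dual P) (P ⊗ dual P) (P ⊗ dual P)
  change IsIso (lam ((α_ (P ⊗ dual P) (P ⊗ dual P) (P ⊗ dual P)).hom ≫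
    (P ⊗ dual P) ◁ (𝟙 _ ⊗≫ P ◁ (dualEv P ▷ dual P) ⊗≫ ((β_ P (dual P)).hom ≫ dualEv P)) ≫
      (ρ_ (P ⊗ dual P)).hom)) at h
  rw [← endShuffle_inv_endMul] at h
  rw [← comp_lam] at h
  exact IsIso.of_isIso_comp_left (endShuffle P).inv _

/-- An algebra `A` with an action on a finite object `P` that identifies `A` with `[P, P]`
satisfies the first Azumaya condition. -/
theorem isIso_azumayaLeft {A P : C} [MonObj A] [IsFiniteObj P] (a : A ⊗ P ⟶ P)
    (ha : μ[A] ▷ P ≫ a = (α_ A A P).hom ≫ A ◁ a ≫ a) [IsIso (lam a)] :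
    IsIso (azumayaLeft A) := by
  let ψ : A ⟶ P ⊗ dual P := lam a ≫ inv (toEnd P)
  have hψ : ψ ▷ P ≫ endAct P = a := by
    apply lam_injective
    rw [← comp_lam]
    change (lam a ≫ inv (toEnd P)) ≫ toEnd P = _
    simp
  have : IsIso (lam (endAct P)) := inferInstanceAs (IsIso (toEnd P))
  -- Multiplicativity of `ψ` is tested on the action on `P`, which is faithful.
  have hμ : μ[A] ≫ ψ = (ψ ⊗ₘ ψ) ≫ endMul P := by
    apply eq_of_isIso_lam (endAct P)
    rw [comp_whiskerRight, Category.assoc, hψ, ha, comp_whiskerRight, Category.assoc,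
      endMul_endAct]
    calc
      _ = (α_ A A P).hom ≫ A ◁ (ψ ▷ P ≫ endAct P) ≫ ψ ▷ P ≫ endAct P := by rw [hψ]
      _ = 𝟙 _ ⊗≫ A ◁ ψ ▷ P ⊗≫ (A ◁ endAct P ≫ ψ ▷ P) ≫ endAct P := by monoidal
      _ = _ := by rw [whisker_exchange, MonoidalCategory.tensorHom_def']; monoidal
  have h := isIso_lam_endMul P
  let e : A ≅ P ⊗ dual P := asIso ψ
  refine isIso_lam_of_iso (e ⊗ᵢ e) e e (f' := (α_ _ _ _).hom ≫ (P ⊗ dual P) ◁ ((β_ _ _).hom ≫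
    endMul P) ≫ endMul P) ?_
  change ((α_ A A A).hom ≫ A ◁ ((β_ A A).hom ≫ μ[A]) ≫ μ[A]) ≫ ψ =
    ((ψ ⊗ₘ ψ) ⊗ₘ ψ) ≫ (α_ _ _ _).hom ≫ (P ⊗ dual P) ◁ ((β_ _ _).hom ≫ endMul P) ≫ endMul P
  have h2 : A ◁ ((β_ A A).hom ≫ μ[A]) ≫ (ψ ⊗ₘ ψ) =
      (ψ ⊗ₘ (ψ ⊗ₘ ψ)) ≫ (P ⊗ dual P) ◁ ((β_ _ _).hom ≫ endMul P) := by
    rw [← id_tensorHom, ← id_tensorHom, tensorHom_comp_tensorHom, tensorHom_comp_tensorHom,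
      Category.assoc, hμ, BraidedCategory.braiding_naturality_assoc]
    simp
  rw [associator_naturality_assoc, ← Category.assoc (ψ ⊗ₘ ψ ⊗ₘ ψ), ← h2]
  simp [hμ]

/-- If `A` braids symmetrically with itself, then the two Azumaya morphisms agree. -/
theorem azumayaRight_eq_left {A : C} [MonObj A] (h : SymmetricPair A A) :
    azumayaRight A = azumayaLeft A := by
  have h' : (β_ A A).hom ≫ (β_ A A).hom = 𝟙 _ := h
  rw [azumayaRight, azumayaLeft]
  congr 1
  calc
    _ = 𝟙 _ ⊗≫ A ◁ (β_ A A).hom ⊗≫ ((β_ A A).hom ≫ (β_ A A).hom) ▷ A ⊗≫ μ[A] ▷ A ≫ μ[A] := by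
      rw [BraidedCategory.braiding_tensor_left_hom]; monoidal
    _ = 𝟙 _ ⊗≫ A ◁ (β_ A A).hom ⊗≫ ((α_ A A A).hom ≫ A ◁ μ[A] ≫ μ[A]) := by
      rw [h', ← MonObj.mul_assoc]; monoidal
    _ = _ := by monoidal

/-! ### Faithful flatness of `T ⊗ H^*` -/

/-- Each `f` is a retract of `A ◁ f`, and a retract of an isomorphism is an isomorphism. -/
theorem reflectsIsomorphisms_of_retract {A : C} (i : 𝟙_ C ⟶ A) (r : A ⟶ 𝟙_ C)
    (h : i ≫ r = 𝟙 _) : (tensorLeft A).ReflectsIsomorphisms := by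
  constructor
  intro X Y f hf
  have hf : IsIso (A ◁ f) := hf
  refine ⟨(λ_ Y).inv ≫ i ▷ Y ≫ inv (A ◁ f) ≫ r ▷ X ≫ (λ_ X).hom, ?_, ?_⟩
  · rw [leftUnitor_inv_naturality_assoc, whisker_exchange_assoc, IsIso.hom_inv_id_assoc,
      ← comp_whiskerRight_assoc, h]
    simp
  · simp only [Category.assoc]
    rw [← leftUnitor_naturality, ← whisker_exchange_assoc, IsIso.inv_hom_id_assoc,
      ← comp_whiskerRight_assoc, h]
    simp

theorem reflectsIsomorphisms_tensor {A B : C} (hA : (tensorLeft A).ReflectsIsomorphisms)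
    (hB : (tensorLeft B).ReflectsIsomorphisms) :
    (tensorLeft (A ⊗ B)).ReflectsIsomorphisms := by
  constructor
  intro X Y f hf
  have hf : IsIso ((A ⊗ B) ◁ f) := hf
  have h1 : IsIso ((tensorLeft A).map ((tensorLeft B).map f)) := by
    change IsIso (A ◁ B ◁ f)
    have : A ◁ B ◁ f = (α_ A B X).inv ≫ (A ⊗ B) ◁ f ≫ (α_ A B Y).hom := by simp
    rw [this]
    infer_instance
  have h2 := isIso_of_reflects_iso ((tensorLeft B).map f) (tensorLeft A)
  exact isIso_of_reflects_iso f (tensorLeft B)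

/-- The unit object is a retract of `H^*` through the counit of `H` and evaluation at `1`, because
`ε(1) = 1`. -/
theorem reflectsIsomorphisms_dual (H : C) [BimonObj H] :
    (tensorLeft (dual H)).ReflectsIsomorphisms := by
  refine reflectsIsomorphisms_of_retract (dualOne H)
    ((ρ_ (dual H)).inv ≫ dual H ◁ η[H] ≫ dualEv H) ?_
  have h1 : dualOne H ▷ H ≫ dualEv H = (λ_ H).hom ≫ ε[H] := lam_ev _
  rw [rightUnitor_inv_naturality_assoc, ← whisker_exchange_assoc, h1, leftUnitor_naturality_assoc,
    BimonObj.one_counit, ← unitors_inv_equal]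
  simp

end Azumaya

end

end BraidedGalois

/-! ### The main theorem -/

theorem mainTheorem8 {C : Type u} [Category.{v} C] [MonoidalCategory C] [BraidedCategory C]
    [MonoidalClosed C] [HasEqualizers C] [HasCoequalizers C]
    (H : C) [HopfObj H] [IsFiniteObj H] [IsCommMonObj H]
    (hlin : IsBraidingLinear H)
    (T : C) [MonObj T] [RightComodObj H T]
    (hT : IsGaloisObj H T)
    (hsymm : (β_ T T).hom = (β_ T T).inv) :
    IsFaithfullyProjective T ∧
      ∃ alg : MonObj (T ⊗ dual H),
        alg.one = smashOne H T ∧ alg.mul = smashMul H T ∧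
          BraidedGalois.IsAzumaya (T ⊗ dual H) := by
  have hH := hlin.isTransparent
  have hc := hlin.comul_braiding
  have hHd := hH.dual
  have := isIso_leftCan (hH T) hT
  have hfin : IsFiniteObj T := isFiniteObj_of_galois (hH T) hT.faithfullyFlat
  have := isIso_lam_smashAct (H := H) (T := T) (hH T)
  refine ⟨isFaithfullyProjective_of_reflects T hT.faithfullyFlat.reflects,
    smashMonObj hc (hH T) hT.isMonHom_coact, rfl, rfl, ?_⟩
  let _ : MonObj (T ⊗ dual H) := smashMonObj hc (hH T) hT.isMonHom_coact
  have := IsFiniteObj.dual H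
  have := IsFiniteObj.tensor T (dual H)
  have hleft : IsIso (azumayaLeft (T ⊗ dual H)) :=
    isIso_azumayaLeft (smashAct H T) (smashMul_smashAct hc (hH T) hT.isMonHom_coact)
  -- The hypothesis on `Φ_{T,T}` enters here: with `H^*` transparent, it makes `T ⊗ H^*` braid
  -- symmetrically with itself.
  have hTA : SymmetricPair T (T ⊗ dual H) :=
    (SymmetricPair.of_hom_eq hsymm).tensor_right (hHd T).symm
  have hA : SymmetricPair (T ⊗ dual H) (T ⊗ dual H) :=
    hTA.symm.tensor_right (hHd _).symm
  refine ⟨isFaithfullyProjective_of_reflects _ (reflectsIsomorphisms_tensor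
    hT.faithfullyFlat.reflects (reflectsIsomorphisms_dual H)), hleft, ?_⟩
  rw [azumayaRight_eq_left hA]
  exact hleft
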